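/- **Theorem 3.2.** Let $d\ge 1$. For $f\in L_2(\mathbb R^d)$ put $\widehat f(\xi)=\int_{\mathbb R^d} f(x)e^{-2\pi i\langle x,\xi\rangle}\,dx$ (extended to $L_2(\mathbb R^d)$ by continuity), and let $H^1(\mathbb R^d)$ be the space of $f\in L_2(\mathbb R^d)$ all of whose first order (distributional) derivatives lie in $L_2(\mathbb R^d)$. A non-zero function $f\in L_2(\mathbb R^d)$ is called *admissible* if $f$ is continuously differentiable, $f\in H^1(\mathbb R^d)$, $\widehat f\in H^1(\mathbb R^d)$, and there are constants $C_1,C_2>0$, $\gamma>\max\{\frac d2+1,d\}$, $\beta>d$ such that for all $x\in\mathbb R^d\setminus\{0\}$ and $j=1,\dots,d$ $$|f(x)|\le \frac{C_1}{\|x\|^{\gamma}},\qquad \Big|\frac{\partial f}{\partial x_j}(x)\Big|\le\frac{C_2}{\|x\|^{\beta}} .$$ For an operator $\mathcal A$ with domain $\mathcal D(\mathcal A)$ in a Hilbert space $\mathcal H$ and a non-zero $f\in\mathcal D(\mathcal A)$ let $$\Delta(\mathcal A,f)=\|\mathcal A f\|^2-\frac{|\langle \mathcal A f,f\rangle|^2}{\|f\|^2},$$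 and let $[\mathcal A,\mathcal B]=\mathcal A\mathcal B-\mathcal B\mathcal A$ with domain $\mathcal D(\mathcal A\mathcal B)\cap\mathcal D(\mathcal B\mathcal A)$. On $L_2(\mathbb R^d)$ let $\mathcal A_jf(x)=2\pi x_jf(x)$ and $\mathcal B_jf=\frac{i}{2\pi}\frac{\partial f}{\partial x_j}$, and on $L_2(\mathbb T^d)$, $\mathbb T^d=\mathbb R^d/\mathbb Z^d$, let $\mathcal A_j^{\mathbb T^d}f(x)=e^{2\pi i x_j}f(x)$ and $\mathcal B_j^{\mathbb T^d}f=\frac{i}{2\pi}\frac{\partial f}{\partial x_j}$ ($j=1,\dots,d$), each on its natural domain of those $f$ in the $L_2$-space for which the result (with distributional derivatives) is again in it. Define $$\mathrm{UP}_{\mathrm{GG}}(f)=\frac{1}{d^2\|f\|_2^4}\sum_{j=1}^d\Delta(\mathcal A_j,f)\sum_{k=1}^d\Delta(\mathcal B_k,f)$$ for non-zero $f\in\bigcap_j \mathcal D(\mathcal A_j)\cap\mathcal D(\mathcal B_j)$, and $$\mathrm{UP}_{\mathrm{GG}}^{\mathbb T^d}(f)=\Big(\sum_{j=1}^d\Delta(\mathcal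 A^{\mathbb T^d}_j,f)\Big)\Big(\sum_{j=1}^d\Delta(\mathcal B^{\mathbb T^d}_j,f)\Big)\Big(\sum_{j=1}^d\big|\langle[\mathcal A^{\mathbb T^d}_j,\mathcal B^{\mathbb T^d}_j]f,f\rangle\big|\Big)^{-2}$$ whenever $f$ is in the domains of all the operators involved and $\langle[\mathcal A^{\mathbb T^d}_j,\mathcal B^{\mathbb T^d}_j]f,f\rangle\ne0$ for all $j$. Let $f$ be admissible, and for $\lambda>0$ put $$f_\lambda(x)=\sqrt{\lambda^d}\,f(\lambda x),\qquad f_\lambda^{\mathrm{per}}(x)=\sum_{k\in\mathbb Z^d}f_\lambda(x+k).$$ Then $f$ lies in the domains of all $\mathcal A_j$ and $\mathcal B_j$. For every $\lambda>0$ the series defining $f_\lambda^{\mathrm{per}}$ converges absolutely at every point, $f_\lambda^{\mathrm{per}}\in L_2(\mathbb T^d)$, and $f_\lambda^{\mathrm{per}}$ lies in the domains of all $\mathcal A_j^{\mathbb T^d}$, $\mathcal B_j^{\mathbb T^d}$ and $[\mathcal A_j^{\mathbb T^d},\mathcal B_j^{\mathbb T^d}]$. For all sufficiently large $\lambda$ the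 numbers $\langle[\mathcal A^{\mathbb T^d}_j,\mathcal B^{\mathbb T^d}_j]f_\lambda^{\mathrm{per}},f_\lambda^{\mathrm{per}}\rangle$ are non-zero for all $j$, so that $\mathrm{UP}_{\mathrm{GG}}^{\mathbb T^d}(f_\lambda^{\mathrm{per}})$ is defined, and $$\lim_{\lambda\to\infty}\mathrm{UP}_{\mathrm{GG}}^{\mathbb T^d}\big(f_\lambda^{\mathrm{per}}\big)=\mathrm{UP}_{\mathrm{GG}}(f).$$ -/

import Mathlib

open MeasureTheory Filter Topology
open scoped ContDiff SchwartzMap FourierTransform LineDeriv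

noncomputable section

namespace GohGoodman

/-! ### Uncertainty products for operators in a Hilbert space -/

section Operators

variable {H : Type*} [NormedAddCommGroup H] [InnerProductSpace ℂ H]

open scoped Classical in
/-- The value `A f` of a partially defined operator `A` (set to `0` when `f` is not in the
domain of `A`; only used for `f` in the domain). -/
def val (A : H →ₗ.[ℂ] H) (f : H) : H :=
  if h : f ∈ A.domain then A ⟨f, h⟩ else 0

/-- The product `A B` of two operators, on its natural domain
`D(AB) = {f ∈ D(B) : B f ∈ D(A)}`. -/
def opMul (A B : H →ₗ.[ℂ] H) : H →ₗ.[ℂ] H :=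
  A.comp (B.domRestrict ((A.domain.comap B.toFun).map B.domain.subtype)) (by
    rintro ⟨x, hx⟩
    obtain ⟨y, hy, rfl⟩ := (Submodule.mem_inf.1 hx).1
    have h : B.domRestrict ((A.domain.comap B.toFun).map B.domain.subtype)
        ⟨B.domain.subtype y, hx⟩ = B y := LinearPMap.domRestrict_apply rfl
    rw [h]
    exact hy)

/-- The commutator `[A, B] = AB - BA`, with domain `D(AB) ∩ D(BA)`. -/
def commutator (A B : H →ₗ.[ℂ] H) : H →ₗ.[ℂ] H :=
  opMul A B - opMul B A

/-- The variance `Δ(A, f) = ‖A f‖² - |⟨A f, f⟩|² / ‖f‖²` of a non-zero `f ∈ D(A)`. -/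
def variance (A : H →ₗ.[ℂ] H) (f : H) : ℝ :=
  ‖val A f‖ ^ 2 - ‖inner ℂ f (val A f)‖ ^ 2 / ‖f‖ ^ 2

/-- The uncertainty product of `f` with respect to two families of operators `A₁, …, Aₙ` and
`B₁, …, Bₙ`, defined when `⟨[Aⱼ, Bⱼ] f, f⟩ ≠ 0` for all `j`. -/
def uncertaintyProduct {n : ℕ} (A B : Fin n → H →ₗ.[ℂ] H) (f : H) : ℝ :=
  (∑ j, variance (A j) f) * (∑ j, variance (B j) f) *
    ((∑ j, ‖inner ℂ f (val (commutator (A j) (B j)) f)‖) ^ 2)⁻¹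

end Operators

/-! ### Function spaces and operators -/

/-- Euclidean space `ℝᵈ`. -/
abbrev Rd (d : ℕ) : Type := EuclideanSpace ℝ (Fin d)

/-- The `j`-th standard basis vector of `ℝᵈ`. -/
def stdVec {d : ℕ} (j : Fin d) : Rd d := EuclideanSpace.single j 1

/-- The vector of `ℝᵈ` given by a point `k` of the lattice `ℤᵈ`. -/
def latticeVec {d : ℕ} (k : Fin d → ℤ) : Rd d := WithLp.toLp 2 (fun j => (k j : ℝ))

/-- The fundamental cube `[-1/2, 1/2)ᵈ`, a model of the torus `𝕋ᵈ = ℝᵈ / ℤᵈ`. -/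
def cube (d : ℕ) : Set (Rd d) := {x | ∀ j, x j ∈ Set.Ico (-1 / 2 : ℝ) (1 / 2)}

/-- Lebesgue measure on the torus `𝕋ᵈ`, modelled on the fundamental cube. -/
def torusMeasure (d : ℕ) : Measure (Rd d) := volume.restrict (cube d)

/-- The Hilbert space `L₂(ℝᵈ)`. -/
abbrev L2R (d : ℕ) := Lp ℂ 2 (volume : Measure (Rd d))

/-- The Hilbert space `L₂(𝕋ᵈ)`. -/
abbrev L2T (d : ℕ) := Lp ℂ 2 (torusMeasure d)

/-- The natural domain `{f ∈ L₂(μ) : m f ∈ L₂(μ)}` of multiplication by the function `m`. -/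
def mulDomain {d : ℕ} (μ : Measure (Rd d)) (m : Rd d → ℂ) : Submodule ℂ (Lp ℂ 2 μ) where
  carrier := {f | MemLp (fun x => m x * f x) 2 μ}
  zero_mem' := by
    refine (memLp_congr_ae ?_).1 (MemLp.zero' (ε := ℂ) (p := 2) (μ := μ))
    filter_upwards [Lp.coeFn_zero ℂ 2 μ] with x hx
    rw [hx, Pi.zero_apply, mul_zero]
  add_mem' := by
    intro f g hf hg
    refine (memLp_congr_ae ?_).1 (MemLp.add hf hg)
    filter_upwards [Lp.coeFn_add f g] with x hx
    rw [hx, Pi.add_apply, Pi.add_apply, mul_add]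
  smul_mem' := by
    intro c f hf
    refine (memLp_congr_ae ?_).1 (MemLp.const_smul hf c)
    filter_upwards [Lp.coeFn_smul c f] with x hx
    rw [hx, Pi.smul_apply, Pi.smul_apply, smul_eq_mul, smul_eq_mul, mul_left_comm]

theorem mem_mulDomain {d : ℕ} {μ : Measure (Rd d)} {m : Rd d → ℂ} {f : Lp ℂ 2 μ}
    (hf : f ∈ mulDomain μ m) : MemLp (fun x => m x * f x) 2 μ := hf

/-- The operator `f ↦ m f` of multiplication by the function `m`, on its natural domain. -/
def mulOp {d : ℕ} (μ : Measure (Rd d)) (m : Rd d → ℂ) : Lp ℂ 2 μ →ₗ.[ℂ] Lp ℂ 2 μ where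
  domain := mulDomain μ m
  toFun :=
    { toFun := fun f => (mem_mulDomain f.2).toLp (fun x => m x * f.1 x)
      map_add' := by
        intro f g
        rw [← MemLp.toLp_add (mem_mulDomain f.2) (mem_mulDomain g.2)]
        refine MemLp.toLp_congr _ _ ?_
        filter_upwards [Lp.coeFn_add f.1 g.1] with x hx
        rw [Submodule.coe_add, hx, Pi.add_apply, Pi.add_apply, mul_add]
      map_smul' := by
        intro c f
        rw [RingHom.id_apply, ← MemLp.toLp_const_smul c (mem_mulDomain f.2)]
        refine MemLp.toLp_congr _ _ ?_
        filter_upwards [Lp.coeFn_smul c f.1] with x hx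
        rw [Submodule.coe_smul, hx, Pi.smul_apply, Pi.smul_apply, smul_eq_mul, smul_eq_mul,
          mul_left_comm] }

/-! #### The operators on `L₂(ℝᵈ)` -/

/-- `g ∈ L₂(ℝᵈ)` is the (distributional) partial derivative `∂f/∂xⱼ` of `f ∈ L₂(ℝᵈ)`. -/
def IsWeakDerivR {d : ℕ} (j : Fin d) (f g : L2R d) : Prop :=
  ∂_{stdVec j} (f : 𝓢'(Rd d, ℂ)) = (g : 𝓢'(Rd d, ℂ))

/-- `f ∈ H¹(ℝᵈ)`: all first order derivatives of `f ∈ L₂(ℝᵈ)` are again in `L₂(ℝᵈ)`. -/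
def MemH1R {d : ℕ} (f : L2R d) : Prop := ∀ j : Fin d, ∃ g : L2R d, IsWeakDerivR j f g

/-- The graph of `f ↦ ∂f/∂xⱼ` in `L₂(ℝᵈ)`. -/
def derivGraphR {d : ℕ} (j : Fin d) : Submodule ℂ (L2R d × L2R d) where
  carrier := {p | IsWeakDerivR j p.1 p.2}
  zero_mem' := by
    have h : ((0 : L2R d) : 𝓢'(Rd d, ℂ)) = 0 :=
      map_zero (Lp.toTemperedDistributionCLM ℂ volume 2)
    simp only [Set.mem_ofPred_eq, IsWeakDerivR, Prod.fst_zero, Prod.snd_zero, h]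
    exact map_zero (LineDeriv.lineDerivOpCLM ℂ 𝓢'(Rd d, ℂ) (stdVec j))
  add_mem' := by
    intro p q hp hq
    have h (u v : L2R d) : ((u + v : L2R d) : 𝓢'(Rd d, ℂ)) = u + v :=
      map_add (Lp.toTemperedDistributionCLM ℂ volume 2) u v
    simp only [Set.mem_ofPred_eq, IsWeakDerivR] at hp hq ⊢
    rw [Prod.fst_add, Prod.snd_add, h, h, ← hp, ← hq]
    exact map_add (LineDeriv.lineDerivOpCLM ℂ 𝓢'(Rd d, ℂ) (stdVec j)) _ _
  smul_mem' := by
    intro c p hp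
    have h (u : L2R d) : ((c • u : L2R d) : 𝓢'(Rd d, ℂ)) = c • (u : 𝓢'(Rd d, ℂ)) :=
      map_smul (Lp.toTemperedDistributionCLM ℂ volume 2) c u
    simp only [Set.mem_ofPred_eq, IsWeakDerivR] at hp ⊢
    rw [Prod.smul_fst, Prod.smul_snd, h, h, ← hp]
    exact map_smul (LineDeriv.lineDerivOpCLM ℂ 𝓢'(Rd d, ℂ) (stdVec j)) c _

/-- Weak derivatives in `L₂(ℝᵈ)` are unique, so `derivGraphR j` is the graph of an operator. -/
theorem derivGraphR_functional {d : ℕ} (j : Fin d) (p : L2R d × L2R d)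
    (hp : p ∈ derivGraphR j) (h0 : p.1 = 0) : p.2 = 0 := by
  have h : ((0 : L2R d) : 𝓢'(Rd d, ℂ)) = 0 :=
    map_zero (Lp.toTemperedDistributionCLM ℂ volume 2)
  have hp' : ∂_{stdVec j} (p.1 : 𝓢'(Rd d, ℂ)) = (p.2 : 𝓢'(Rd d, ℂ)) := hp
  rw [h0, h] at hp'
  have hz : ∂_{stdVec j} (0 : 𝓢'(Rd d, ℂ)) = 0 :=
    map_zero (LineDeriv.lineDerivOpCLM ℂ 𝓢'(Rd d, ℂ) (stdVec j))
  rw [hz] at hp'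
  have hk := Lp.ker_toTemperedDistributionCLM_eq_bot (F := ℂ) (p := 2)
    (μ := (volume : Measure (Rd d)))
  have : p.2 ∈ (Lp.toTemperedDistributionCLM ℂ (volume : Measure (Rd d)) 2).ker := hp'.symm
  rw [hk] at this
  simpa using this

/-- The position operator `(Aⱼ f)(x) = 2π xⱼ f(x)` on `L₂(ℝᵈ)`. -/
def opA {d : ℕ} (j : Fin d) : L2R d →ₗ.[ℂ] L2R d :=
  mulOp volume (fun x => ((2 * Real.pi * x j : ℝ) : ℂ))

/-- The momentum operator `Bⱼ f = (i / 2π) ∂f/∂xⱼ` on `L₂(ℝᵈ)`, with domain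
`{f ∈ L₂(ℝᵈ) : ∂f/∂xⱼ ∈ L₂(ℝᵈ)}`. -/
def opB {d : ℕ} (j : Fin d) : L2R d →ₗ.[ℂ] L2R d :=
  (Complex.I / (2 * Real.pi : ℂ)) • (derivGraphR j).toLinearPMap

/-- The Goh–Goodman uncertainty product on `ℝᵈ`,
`UP_GG(f) = (d² ‖f‖⁴)⁻¹ ∑ⱼ Δ(Aⱼ, f) ∑ₖ Δ(Bₖ, f)`. -/
def UPGG {d : ℕ} (f : L2R d) : ℝ :=
  1 / ((d : ℝ) ^ 2 * ‖f‖ ^ 4) * (∑ j, variance (opA j) f) * (∑ k, variance (opB k) f)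

/-! #### The operators on `L₂(𝕋ᵈ)` -/

/-- Smooth `ℤᵈ`-periodic functions on `ℝᵈ`, i.e. smooth functions on the torus `𝕋ᵈ`. -/
def IsPeriodicTest {d : ℕ} (φ : Rd d → ℂ) : Prop :=
  ContDiff ℝ ∞ φ ∧ ∀ (k : Fin d → ℤ) (x : Rd d), φ (x + latticeVec k) = φ x

/-- `g ∈ L₂(𝕋ᵈ)` is the weak partial derivative `∂f/∂xⱼ` of `f ∈ L₂(𝕋ᵈ)`. -/
def IsWeakDerivT {d : ℕ} (j : Fin d) (f g : L2T d) : Prop :=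
  ∀ φ : Rd d → ℂ, IsPeriodicTest φ →
    ∫ x, f x * fderiv ℝ φ x (stdVec j) ∂(torusMeasure d) = -∫ x, g x * φ x ∂(torusMeasure d)

theorem cube_subset {d : ℕ} : cube d ⊆ Metric.closedBall (0 : Rd d) (Real.sqrt d) := by
  intro x hx
  rw [mem_closedBall_zero_iff, EuclideanSpace.norm_eq]
  refine Real.sqrt_le_sqrt ?_
  calc ∑ i, ‖x i‖ ^ 2 ≤ ∑ _i : Fin d, (1 : ℝ) := by
        refine Finset.sum_le_sum fun i _ => ?_
        have h := hx i
        rw [Set.mem_Ico] at h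
        rw [Real.norm_eq_abs, sq_abs]
        nlinarith [h.1, h.2]
    _ = d := by simp

theorem measurableSet_cube {d : ℕ} : MeasurableSet (cube d) := by
  have : cube d = ⋂ j, (fun x : Rd d => x j) ⁻¹' Set.Ico (-1 / 2 : ℝ) (1 / 2) := by
    ext x; simp [cube]
  rw [this]
  exact MeasurableSet.iInter fun j => measurableSet_Ico.preimage (by fun_prop)

instance instFiniteTorusMeasure (d : ℕ) : IsFiniteMeasure (torusMeasure d) := by
  refine ⟨?_⟩
  rw [torusMeasure, Measure.restrict_apply_univ]
  exact (measure_mono cube_subset).trans_lt measure_closedBall_lt_top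

/-- Continuous functions are square integrable on the torus. -/
theorem memLp_torus {d : ℕ} {φ : Rd d → ℂ} (hφ : Continuous φ) :
    MemLp φ 2 (torusMeasure d) := by
  obtain ⟨C, hC⟩ := (isCompact_closedBall (0 : Rd d) (Real.sqrt d)).exists_bound_of_continuousOn
    hφ.continuousOn
  refine MemLp.of_bound hφ.aestronglyMeasurable C ?_
  rw [torusMeasure, ae_restrict_iff' measurableSet_cube]
  exact Eventually.of_forall fun x hx => hC x (cube_subset hx)

/-- Products of `L₂(𝕋ᵈ)` functions with continuous functions are integrable. -/
theorem integrable_torus {d : ℕ} (f : L2T d) {φ : Rd d → ℂ} (hφ : Continuous φ) :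
    Integrable (fun x => f x * φ x) (torusMeasure d) :=
  (Lp.memLp f).integrable_mul (memLp_torus hφ)

/-- The graph of `f ↦ ∂f/∂xⱼ` in `L₂(𝕋ᵈ)`. -/
def derivGraphT {d : ℕ} (j : Fin d) : Submodule ℂ (L2T d × L2T d) where
  carrier := {p | IsWeakDerivT j p.1 p.2}
  zero_mem' := by
    intro φ _
    have h : ((0 : L2T d) : Rd d → ℂ) =ᵐ[torusMeasure d] 0 := Lp.coeFn_zero ℂ 2 _
    have h1 : ∫ x, (0 : L2T d) x * fderiv ℝ φ x (stdVec j) ∂(torusMeasure d) = 0 := by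
      refine integral_eq_zero_of_ae ?_
      filter_upwards [h] with x hx
      rw [hx, Pi.zero_apply, zero_mul]
    have h2 : ∫ x, (0 : L2T d) x * φ x ∂(torusMeasure d) = 0 := by
      refine integral_eq_zero_of_ae ?_
      filter_upwards [h] with x hx
      rw [hx, Pi.zero_apply, zero_mul]
    simp only [Prod.fst_zero, Prod.snd_zero]
    rw [h1, h2, neg_zero]
  add_mem' := by
    intro p q hp hq φ hφ
    have hc : Continuous φ := hφ.1.continuous
    have hd : Continuous fun x => fderiv ℝ φ x (stdVec j) :=
      (hφ.1.continuous_fderiv (by simp)).clm_apply continuous_const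
    have key (u v : L2T d) {ψ : Rd d → ℂ} (hψ : Continuous ψ) :
        ∫ x, (u + v : L2T d) x * ψ x ∂(torusMeasure d) =
          ∫ x, u x * ψ x ∂(torusMeasure d) + ∫ x, v x * ψ x ∂(torusMeasure d) := by
      rw [← integral_add (integrable_torus u hψ) (integrable_torus v hψ)]
      refine integral_congr_ae ?_
      filter_upwards [Lp.coeFn_add u v] with x hx
      rw [hx, Pi.add_apply, add_mul]
    simp only [Prod.fst_add, Prod.snd_add]
    rw [key _ _ hd, key _ _ hc, hp φ hφ, hq φ hφ, neg_add]
  smul_mem' := by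
    intro c p hp φ hφ
    have key (u : L2T d) (ψ : Rd d → ℂ) :
        ∫ x, (c • u : L2T d) x * ψ x ∂(torusMeasure d) =
          c * ∫ x, u x * ψ x ∂(torusMeasure d) := by
      rw [← integral_const_mul]
      refine integral_congr_ae ?_
      filter_upwards [Lp.coeFn_smul c u] with x hx
      simp [hx, mul_assoc]
    simp only [Prod.smul_fst, Prod.smul_snd]
    rw [key _ (fun x => fderiv ℝ φ x (stdVec j)), key, hp φ hφ, mul_neg]

/-- The periodization `x ↦ ∑_{k ∈ ℤᵈ} g(x + k)`. -/
def periodization {d : ℕ} (g : Rd d → ℂ) (x : Rd d) : ℂ :=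
  ∑' k : Fin d → ℤ, g (x + latticeVec k)

theorem periodization_add {d : ℕ} (g : Rd d → ℂ) (k : Fin d → ℤ) (x : Rd d) :
    periodization g (x + latticeVec k) = periodization g x := by
  unfold periodization
  rw [← (Equiv.addLeft k).tsum_eq (fun l => g (x + latticeVec l))]
  refine tsum_congr fun l => ?_
  congr 1
  ext j
  simp [latticeVec, add_assoc]

theorem finite_lattice {d : ℕ} (M : ℝ) : {k : Fin d → ℤ | ‖latticeVec k‖ ≤ M}.Finite := by
  refine (Set.finite_Icc (fun _ : Fin d => -⌈M⌉) (fun _ => ⌈M⌉)).subset ?_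
  intro k hk
  have h (j : Fin d) : |(k j : ℝ)| ≤ ⌈M⌉ := by
    have h1 := (PiLp.norm_apply_le (latticeVec k) j).trans hk
    rw [Real.norm_eq_abs] at h1
    exact h1.trans (Int.le_ceil M)
  refine ⟨fun j => ?_, fun j => ?_⟩
  · have := (abs_le.1 (h j)).1
    exact_mod_cast this
  · have := (abs_le.1 (h j)).2
    exact_mod_cast this

theorem isPeriodicTest_periodization {d : ℕ} {g : Rd d → ℂ} (hg : ContDiff ℝ ∞ g)
    (hc : HasCompactSupport g) : IsPeriodicTest (periodization g) := by
  refine ⟨?_, periodization_add g⟩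
  obtain ⟨R, hR⟩ := hc.isCompact.isBounded.subset_closedBall (0 : Rd d)
  refine contDiff_iff_contDiffAt.2 fun x₀ => ?_
  have hfin := finite_lattice (d := d) (R + (‖x₀‖ + 1))
  have hev : periodization g =ᶠ[𝓝 x₀] fun x => ∑ k ∈ hfin.toFinset, g (x + latticeVec k) := by
    filter_upwards [Metric.ball_mem_nhds x₀ one_pos] with x hx
    refine tsum_eq_sum fun k hk => ?_
    by_contra hne
    refine hk (hfin.mem_toFinset.2 ?_)
    have h1 : ‖x + latticeVec k‖ ≤ R := by
      simpa using hR (subset_tsupport g hne)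
    have h2 : ‖x‖ ≤ ‖x₀‖ + 1 := by
      have h3 : ‖x - x₀‖ < 1 := by simpa [dist_eq_norm] using hx
      have h4 : ‖x‖ ≤ ‖x₀‖ + ‖x - x₀‖ := by
        simpa using norm_add_le x₀ (x - x₀)
      linarith
    have h5 : ‖latticeVec k‖ ≤ ‖x + latticeVec k‖ + ‖x‖ := by
      simpa using norm_sub_le (x + latticeVec k) x
    show ‖latticeVec k‖ ≤ _
    linarith
  refine ContDiffAt.congr_of_eventuallyEq ?_ hev
  exact ContDiffAt.sum fun k _ =>
    (hg.comp (contDiff_id.add contDiff_const)).contDiffAt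

theorem periodization_eq_self {d : ℕ} {g : Rd d → ℂ} (hg : tsupport g ⊆ cube d) {x : Rd d}
    (hx : x ∈ cube d) : periodization g x = g x := by
  unfold periodization
  rw [tsum_eq_single 0]
  · congr 1
    ext j
    simp [latticeVec]
  · intro k hk
    by_contra hne
    refine hk (funext fun j => ?_)
    have h1 := hg (subset_tsupport g hne) j
    have h2 := hx j
    simp only [latticeVec, PiLp.add_apply, Set.mem_Ico] at h1 h2
    have h3 : (k j : ℝ) < (1 : ℤ) := by push_cast; linarith [h1.2, h2.1]
    have h4 : ((-1 : ℤ) : ℝ) < k j := by push_cast; linarith [h1.1, h2.2]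
    have h5 := Int.cast_lt.1 h3
    have h6 := Int.cast_lt.1 h4
    simp only [Pi.zero_apply]
    omega

theorem convex_cube {d : ℕ} : Convex ℝ (cube d) := by
  intro x hx y hy a b ha hb hab j
  exact convex_Ico (-1 / 2 : ℝ) (1 / 2) (hx j) (hy j) ha hb hab

/-- Weak derivatives in `L₂(𝕋ᵈ)` are unique, so `derivGraphT j` is the graph of an operator. -/
theorem derivGraphT_functional {d : ℕ} (j : Fin d) (p : L2T d × L2T d)
    (hp : p ∈ derivGraphT j) (h0 : p.1 = 0) : p.2 = 0 := by
  have hint : Integrable p.2 (torusMeasure d) := (Lp.memLp p.2).integrable (by norm_num)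
  have hmain : ∀ᵐ x ∂(torusMeasure d), x ∈ interior (cube d) → p.2 x = 0 := by
    refine isOpen_interior.ae_eq_zero_of_integral_contDiff_smul_eq_zero
      (hint.locallyIntegrable.locallyIntegrableOn _) ?_
    intro g hg hc hs
    have hg' : ContDiff ℝ ∞ fun x => (g x : ℂ) := Complex.ofRealCLM.contDiff.comp hg
    have hc' : HasCompactSupport fun x => (g x : ℂ) :=
      hc.comp_left (g := fun t : ℝ => (t : ℂ)) (by simp)
    have hs' : tsupport (fun x => (g x : ℂ)) ⊆ cube d := by
      have : tsupport (fun x => (g x : ℂ)) ⊆ tsupport g :=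
        closure_mono fun x hx => by simpa using hx
      exact this.trans (hs.trans interior_subset)
    have h := hp _ (isPeriodicTest_periodization hg' hc')
    have hz : ∫ x, p.1 x * fderiv ℝ (periodization fun x => (g x : ℂ)) x (stdVec j)
        ∂(torusMeasure d) = 0 := by
      refine integral_eq_zero_of_ae ?_
      rw [h0]
      filter_upwards [Lp.coeFn_zero ℂ 2 (torusMeasure d)] with x hx
      rw [hx, Pi.zero_apply, zero_mul]
    rw [hz, eq_comm, neg_eq_zero] at h
    rw [← h]
    refine integral_congr_ae ?_
    have hmem : ∀ᵐ x ∂(torusMeasure d), x ∈ cube d := ae_restrict_mem measurableSet_cube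
    filter_upwards [hmem] with x hx
    rw [periodization_eq_self hs' hx, Complex.real_smul, mul_comm]
  refine (Lp.eq_zero_iff_ae_eq_zero).2 ?_
  have hfr : ∀ᵐ x ∂(torusMeasure d), x ∉ frontier (cube d) := by
    refine ae_restrict_of_ae ?_
    exact measure_eq_zero_iff_ae_notMem.1 (convex_cube.addHaar_frontier volume)
  filter_upwards [hmain, hfr, ae_restrict_mem measurableSet_cube] with x h1 h2 h3
  exact h1 (by
    by_contra h
    exact h2 ⟨subset_closure h3, h⟩)

/-- The operator `(A_j^𝕋 f)(x) = exp(2πi xⱼ) f(x)` on `L₂(𝕋ᵈ)`. -/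
def opAT {d : ℕ} (j : Fin d) : L2T d →ₗ.[ℂ] L2T d :=
  mulOp (torusMeasure d) (fun x => Complex.exp (2 * Real.pi * Complex.I * (x j : ℂ)))

/-- The operator `B_j^𝕋 f = (i / 2π) ∂f/∂xⱼ` on `L₂(𝕋ᵈ)`, with domain
`{f ∈ L₂(𝕋ᵈ) : ∂f/∂xⱼ ∈ L₂(𝕋ᵈ)}`. -/
def opBT {d : ℕ} (j : Fin d) : L2T d →ₗ.[ℂ] L2T d :=
  (Complex.I / (2 * Real.pi : ℂ)) • (derivGraphT j).toLinearPMap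

/-- The periodic Goh–Goodman uncertainty product. -/
def UPGGT {d : ℕ} (f : L2T d) : ℝ := uncertaintyProduct opAT opBT f

/-! ### Admissible functions and scaling -/

/-- Admissible functions on `ℝᵈ`. -/
structure Admissible {d : ℕ} (f : Rd d → ℂ) : Prop where
  ne_zero : f ≠ 0
  memLp : MemLp f 2 volume
  contDiff : ContDiff ℝ 1 f
  memH1 : MemH1R (memLp.toLp f)
  memH1_fourier : MemH1R (𝓕 (memLp.toLp f))
  decay : ∃ C₁ > (0 : ℝ), ∃ γ > max ((d : ℝ) / 2 + 1) d,
    ∀ x : Rd d, x ≠ 0 → ‖f x‖ ≤ C₁ / ‖x‖ ^ γ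
  decay_deriv : ∃ C₂ > (0 : ℝ), ∃ β > (d : ℝ),
    ∀ x : Rd d, x ≠ 0 → ∀ j : Fin d, ‖fderiv ℝ f x (stdVec j)‖ ≤ C₂ / ‖x‖ ^ β

/-- The scaled function `f_lam(x) = √(lamᵈ) f(lam x)`. -/
def scale {d : ℕ} (f : Rd d → ℂ) (lam : ℝ) (x : Rd d) : ℂ :=
  (Real.sqrt (lam ^ d) : ℂ) * f (lam • x)

open scoped Classical in
/-- The element of `L₂(𝕋ᵈ)` given by a `ℤᵈ`-periodic function (set to `0` when the function is
not square integrable over the torus). -/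
def toL2T {d : ℕ} (g : Rd d → ℂ) : L2T d :=
  if h : MemLp g 2 (torusMeasure d) then h.toLp g else 0

/-- The periodized scaled function `f_lam^per = ∑_{k ∈ ℤᵈ} f_lam(· + k)` as an element of
`L₂(𝕋ᵈ)`. -/
def scaledPer {d : ℕ} (f : Rd d → ℂ) (lam : ℝ) : L2T d := toL2T (periodization (scale f lam))

end GohGoodman

end

noncomputable section

namespace GohGoodman

/-! ### The lattice `ℤᵈ` and the fundamental cube -/

section Lattice

variable {d : ℕ}

/-! Undo the scaling. The map `dilate`, sending `F` on the cube to `lam ^ (-d/2) F(x / lam)` on the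
dilated cube, extended by zero, preserves inner products from `L₂(𝕋ᵈ)` to `L₂(ℝᵈ)`. Every norm and
inner product in the periodic uncertainty product can therefore be computed in `L₂(ℝᵈ)`, where
limits can be taken.

On the dilated cube, the dilate of the periodized function is `f` plus the terms with `k ≠ 0`. By
decay of order `b` these are `O(lam ^ (-b))` uniformly, on a set of volume `lam ^ d`, so a weight of
size `lam ^ s` leaves an `L₂` error `O(lam ^ (s + d/2 - b))`. The remaining term converges by
dominated convergence. This is `tendsto_dilate`. With `s = 0` it gives convergence to `f` and, after
division by the chain rule factor `lam`, to the partial derivatives of `f`.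

For the multiplication operators, the variance does not change when a multiple of `f` is added to
the image (`vecVariance_add_self`), so `exp(2πi xⱼ)` may be replaced by `exp(2πi xⱼ) - 1`.
Multiplied by `lam`, this has the dilated limit `2πi xⱼ f`. Here `s = 1`, which is where decay
beyond `d/2 + 1` is needed.

The two variance sums thus scale like `lam ^ (-2)` and `lam ^ 2`, and these factors cancel. The
commutator is multiplication by `exp(2πi xⱼ)` (`mem_graph_commutator`), so each commutator term
tends to `‖f‖²`; summing over `j` and squaring gives the normalization `d² ‖f‖⁴`. -/

theorem latticeVec_apply (k : Fin d → ℤ) (j : Fin d) : latticeVec k j = (k j : ℝ) := rfl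

theorem latticeVec_injective : Function.Injective (latticeVec (d := d)) := by
  intro k l h
  funext j
  have := congrArg (fun v : Rd d => v j) h
  simpa [latticeVec_apply] using this

theorem latticeVec_add (k l : Fin d → ℤ) : latticeVec (k + l) = latticeVec k + latticeVec l := by
  ext j; simp [latticeVec]

/-- The translates of the cube by lattice vectors cover `ℝᵈ`. -/
theorem exists_add_latticeVec_mem_cube (x : Rd d) : ∃ k, x + latticeVec k ∈ cube d := by
  refine ⟨fun j => -⌊x j + 1 / 2⌋, fun j => ?_⟩
  have h1 := Int.floor_le (x j + 1 / 2)
  have h2 := Int.lt_floor_add_one (x j + 1 / 2)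
  simp only [PiLp.add_apply, latticeVec_apply, Set.mem_Ico]
  push_cast
  constructor <;> linarith

/-- Distinct lattice translates of the cube are disjoint. -/
theorem eq_of_add_latticeVec_mem_cube {x : Rd d} {k l : Fin d → ℤ}
    (hk : x + latticeVec k ∈ cube d) (hl : x + latticeVec l ∈ cube d) : k = l := by
  funext j
  have h1 := hk j
  have h2 := hl j
  simp only [PiLp.add_apply, latticeVec_apply, Set.mem_Ico] at h1 h2
  have h3 : (k j : ℝ) < (l j + 1 : ℤ) := by push_cast; linarith [h1.2, h2.1]
  have h4 : (l j : ℝ) < (k j + 1 : ℤ) := by push_cast; linarith [h1.1, h2.2]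
  have h5 := Int.cast_lt.1 h3
  have h6 := Int.cast_lt.1 h4
  omega

/-- Compare coordinates: if `k j ≠ 0` then `|x j| ≤ 1/2 ≤ |k j| / 2`, hence `|k j| ≤ 2 |x j + k j|`.
This bounds periodization tails by a lattice sum independent of `x`. -/
theorem norm_latticeVec_le {x : Rd d} (hx : x ∈ cube d) (k : Fin d → ℤ) :
    ‖latticeVec k‖ ≤ 2 * ‖x + latticeVec k‖ := by
  have h : ‖latticeVec k‖ ≤ ‖(2 : ℝ) • (x + latticeVec k)‖ := by
    rw [EuclideanSpace.norm_eq, EuclideanSpace.norm_eq]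
    refine Real.sqrt_le_sqrt (Finset.sum_le_sum fun j _ => ?_)
    have hj := hx j
    rw [Set.mem_Ico] at hj
    rw [Real.norm_eq_abs, Real.norm_eq_abs, sq_le_sq, abs_abs, abs_abs]
    simp only [PiLp.smul_apply, PiLp.add_apply, latticeVec_apply, smul_eq_mul]
    rcases lt_trichotomy (k j) 0 with h | h | h
    · have : (k j : ℝ) ≤ -1 := by exact_mod_cast (by omega : k j ≤ -1)
      rw [abs_of_nonpos (by linarith), abs_of_nonpos (by linarith)]
      linarith
    · simp [h]
    · have : (1 : ℝ) ≤ k j := by exact_mod_cast (by omega : 1 ≤ k j)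
      rw [abs_of_nonneg (by linarith), abs_of_nonneg (by linarith)]
      linarith
  rwa [norm_smul, Real.norm_ofNat] at h

/-- The sum is dominated by nothing new: it is the standard power sum over a lattice of rank `d`,
reindexed by integer coordinates. The term `k = 0` is `0 ^ (-b) = 0`, since `b > 0`. -/
theorem summable_norm_latticeVec {b : ℝ} (hb : (d : ℝ) < b) :
    Summable fun k : Fin d → ℤ => ‖latticeVec k‖ ^ (-b) := by
  let B := (EuclideanSpace.basisFun (Fin d) ℝ).toBasis
  let L : Submodule ℤ (Rd d) := Submodule.span ℤ (Set.range B)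
  have hr : Module.finrank ℤ L = d := by
    rw [ZLattice.rank ℝ L]; simp
  have hs := ZLattice.summable_norm_rpow L (-b) (by rw [hr]; linarith)
  have hmem (k : Fin d → ℤ) : latticeVec k ∈ L := by
    have : latticeVec k = ∑ j, k j • B j := by
      ext i
      simp [B, latticeVec, Finset.sum_apply, Pi.single_apply]
    rw [this]
    exact Submodule.sum_mem _ fun j _ =>
      Submodule.smul_mem _ _ (Submodule.subset_span (Set.mem_range_self j))
  exact hs.comp_injective (i := fun k => (⟨latticeVec k, hmem k⟩ : L)) fun k l h =>
    latticeVec_injective (congrArg Subtype.val h)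

end Lattice

/-! ### Functions with polynomial decay -/

/-- `g` is continuous and decays at least like `(1 + ‖x‖) ^ (-b)`. -/
structure HasDecay {d : ℕ} (g : Rd d → ℂ) (b : ℝ) : Prop where
  continuous : Continuous g
  bound : ∃ C > 0, ∀ x, ‖g x‖ ≤ C * (1 + ‖x‖) ^ (-b)

section Decay

variable {d : ℕ} {g : Rd d → ℂ} {b : ℝ}

/-- The hypothesis may blow up at the origin, so compactness bounds `g` on the unit ball; outside it
`1 + ‖x‖ ≤ 2 ‖x‖`, which costs the factor `2 ^ b`. Absolute values appear in the constant because
the signs of `M` and `C` are unknown. -/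
theorem HasDecay.of_le (hg : Continuous g) (hb : 0 < b) {C : ℝ}
    (h : ∀ x, x ≠ 0 → ‖g x‖ ≤ C / ‖x‖ ^ b) : HasDecay g b := by
  refine ⟨hg, ?_⟩
  obtain ⟨M, hM⟩ := (isCompact_closedBall (0 : Rd d) 1).exists_bound_of_continuousOn
    hg.continuousOn
  have h2 : (0 : ℝ) < 2 ^ b := by positivity
  refine ⟨(|M| + |C| + 1) * 2 ^ b, by positivity, fun x => ?_⟩
  have hx0 : 0 < 1 + ‖x‖ := by positivity
  rw [Real.rpow_neg hx0.le, ← div_eq_mul_inv, le_div_iff₀ (by positivity)]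
  rcases le_or_gt ‖x‖ 1 with hx | hx
  · refine mul_le_mul ?_ (Real.rpow_le_rpow hx0.le (by linarith) hb.le) (by positivity)
      (by positivity)
    have := hM x (by simpa using hx)
    linarith [le_abs_self M, abs_nonneg C]
  · have hx1 : 0 < ‖x‖ := by linarith
    have h3 := h x (norm_pos_iff.1 hx1)
    rw [le_div_iff₀ (by positivity)] at h3
    calc ‖g x‖ * (1 + ‖x‖) ^ b ≤ ‖g x‖ * (2 * ‖x‖) ^ b := by
          gcongr; linarith
      _ = ‖g x‖ * ‖x‖ ^ b * 2 ^ b := by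
          rw [Real.mul_rpow (by norm_num) hx1.le]; ring
      _ ≤ C * 2 ^ b := by gcongr
      _ ≤ _ := by
          gcongr
          linarith [le_abs_self C, abs_nonneg M]

theorem HasDecay.integrable (h : HasDecay g b) (hb : (d : ℝ) < b) : Integrable g := by
  obtain ⟨C, hC, h1⟩ := h.bound
  exact ((integrable_one_add_norm (by simpa using hb)).const_mul C).mono'
    h.continuous.aestronglyMeasurable (Eventually.of_forall h1)

theorem HasDecay.memLp (h : HasDecay g b) (hb : (d : ℝ) < 2 * b) : MemLp g 2 volume := by
  obtain ⟨C, hC, h1⟩ := h.bound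
  rw [memLp_two_iff_integrable_sq_norm h.continuous.aestronglyMeasurable]
  refine ((integrable_one_add_norm (E := Rd d) (r := 2 * b) (by simpa using hb)).const_mul
    (C ^ 2)).mono' (h.continuous.norm.pow 2).aestronglyMeasurable (Eventually.of_forall fun x => ?_)
  have hx0 : 0 < 1 + ‖x‖ := by positivity
  rw [Real.norm_of_nonneg (by positivity)]
  calc ‖g x‖ ^ 2 ≤ (C * (1 + ‖x‖) ^ (-b)) ^ 2 := by gcongr; exact h1 x
    _ = C ^ 2 * (1 + ‖x‖) ^ (-(2 * b)) := by
      rw [mul_pow, ← Real.rpow_natCast, ← Real.rpow_natCast, ← Real.rpow_mul hx0.le]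
      congr 2; push_cast; ring

/-- Multiplication by a coordinate costs one power of decay. -/
theorem HasDecay.coord_mul (h : HasDecay g b) (j : Fin d) :
    HasDecay (fun x => (x j : ℂ) * g x) (b - 1) := by
  obtain ⟨C, hC, h1⟩ := h.bound
  refine ⟨(Complex.continuous_ofReal.comp (by fun_prop)).mul h.continuous, C, hC, fun x => ?_⟩
  have hx0 : 0 < 1 + ‖x‖ := by positivity
  rw [norm_mul, Complex.norm_real]
  calc ‖x j‖ * ‖g x‖ ≤ (1 + ‖x‖) * (C * (1 + ‖x‖) ^ (-b)) := by
        gcongr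
        · linarith [PiLp.norm_apply_le x j]
        · exact h1 x
    _ = C * (1 + ‖x‖) ^ (-(b - 1)) := by
        rw [show -(b - 1) = 1 + -b by ring, Real.rpow_add hx0, Real.rpow_one]; ring

theorem HasDecay.scale (h : HasDecay g b) {lam : ℝ} (hl : 0 < lam) (hb : 0 < b) :
    HasDecay (scale g lam) b := by
  obtain ⟨C, hC, h1⟩ := h.bound
  refine HasDecay.of_le (C := Real.sqrt (lam ^ d) * C * lam ^ (-b)) ?_ hb fun x hx => ?_
  · exact continuous_const.mul (h.continuous.comp (continuous_const_smul lam))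
  · have hx1 : 0 < ‖x‖ := norm_pos_iff.2 hx
    rw [GohGoodman.scale, norm_mul, Complex.norm_real, Real.norm_of_nonneg (Real.sqrt_nonneg _),
      div_eq_mul_inv, ← Real.rpow_neg hx1.le, mul_assoc, mul_assoc]
    gcongr
    refine (h1 _).trans ?_
    gcongr
    rw [← Real.mul_rpow hl.le hx1.le]
    refine Real.rpow_le_rpow_of_nonpos (by positivity) ?_ (by linarith)
    rw [norm_smul, Real.norm_of_nonneg hl.le]; linarith

/-- Bound for the terms of a periodization at points of the cube. -/
theorem norm_add_latticeVec_le {C : ℝ} (hC : 0 ≤ C) (hb : 0 < b)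
    (hg : ∀ x, ‖g x‖ ≤ C * (1 + ‖x‖) ^ (-b)) {lam : ℝ} (hl : 0 < lam)
    {x : Rd d} (hx : x ∈ cube d) {k : Fin d → ℤ} (hk : k ≠ 0) :
    ‖g (lam • (x + latticeVec k))‖ ≤ C * 2 ^ b * lam ^ (-b) * ‖latticeVec k‖ ^ (-b) := by
  have hk' : 0 < ‖latticeVec k‖ := by
    rw [norm_pos_iff]
    intro h
    exact hk (latticeVec_injective (h.trans (by ext j; simp [latticeVec])))
  refine (hg _).trans ?_
  have h2 : (2 : ℝ) ^ b = (2⁻¹ : ℝ) ^ (-b) := by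
    rw [Real.rpow_neg (by norm_num), Real.inv_rpow (by norm_num), inv_inv]
  rw [mul_assoc, mul_assoc, h2, ← Real.mul_rpow hl.le hk'.le,
    ← Real.mul_rpow (by norm_num) (by positivity)]
  have hpos : 0 < (2 : ℝ)⁻¹ * (lam * ‖latticeVec k‖) := by positivity
  refine mul_le_mul_of_nonneg_left (Real.rpow_le_rpow_of_nonpos hpos ?_ (by linarith)) hC
  rw [norm_smul, Real.norm_of_nonneg hl.le]
  have := norm_latticeVec_le hx k
  nlinarith

theorem HasDecay.summable_norm_of_mem_cube (h : HasDecay g b) (hb : (d : ℝ) < b) {x : Rd d}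
    (hx : x ∈ cube d) : Summable fun k : Fin d → ℤ => ‖g (x + latticeVec k)‖ := by
  obtain ⟨C, hC, h1⟩ := h.bound
  have hb0 : 0 < b := (Nat.cast_nonneg d).trans_lt hb
  -- The lattice bound only covers `k ≠ 0`; the single term `k = 0` is the finite exceptional set.
  refine Summable.of_norm_bounded_eventually
    ((summable_norm_latticeVec hb).mul_left (C * 2 ^ b * 1 ^ (-b))) ?_
  rw [eventually_cofinite]
  refine (Set.finite_singleton (0 : Fin d → ℤ)).subset fun k hk => ?_
  by_contra hk0
  refine hk ?_
  rw [norm_norm]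
  have := norm_add_latticeVec_le hC.le hb0 h1 one_pos hx hk0
  rwa [one_smul] at this

/-- A shift of the summation index moves any point into the cube. -/
theorem HasDecay.summable_norm (h : HasDecay g b) (hb : (d : ℝ) < b) (x : Rd d) :
    Summable fun k : Fin d → ℤ => ‖g (x + latticeVec k)‖ := by
  obtain ⟨l, hl⟩ := exists_add_latticeVec_mem_cube x
  have := h.summable_norm_of_mem_cube hb hl
  rw [← (Equiv.addLeft l).summable_iff]
  refine this.congr fun k => ?_
  simp [latticeVec_add, add_assoc]

theorem HasDecay.summable (h : HasDecay g b) (hb : (d : ℝ) < b) (x : Rd d) :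
    Summable fun k : Fin d → ℤ => g (x + latticeVec k) :=
  (h.summable_norm hb x).of_norm

theorem HasDecay.measurable_periodization (h : HasDecay g b) (hb : (d : ℝ) < b) :
    Measurable (periodization g) := by
  refine measurable_of_tendsto_metrizable' (u := atTop)
    (f := fun (s : Finset (Fin d → ℤ)) x => ∑ k ∈ s, g (x + latticeVec k)) (fun s => ?_) ?_
  · exact Finset.measurable_sum _ fun k _ =>
      (h.continuous.comp (continuous_id.add continuous_const)).measurable
  · rw [tendsto_pi_nhds]
    exact fun x => (h.summable hb x).hasSum

/-- On the cube, the periodization of a rescaled function differs little from the function. -/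
theorem HasDecay.exists_norm_periodization_sub_le (h : HasDecay g b) (hb : (d : ℝ) < b) :
    ∃ K : ℝ, 0 ≤ K ∧ ∀ lam : ℝ, 0 < lam → ∀ x ∈ cube d,
      ‖periodization (GohGoodman.scale g lam) x - GohGoodman.scale g lam x‖ ≤
        Real.sqrt (lam ^ d) * (K * lam ^ (-b)) := by
  obtain ⟨C, hC, h1⟩ := h.bound
  have hb0 : 0 < b := (Nat.cast_nonneg d).trans_lt hb
  have hs := summable_norm_latticeVec hb
  have hS0 : 0 ≤ ∑' k : Fin d → ℤ, ‖latticeVec k‖ ^ (-b) := tsum_nonneg fun k => by positivity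
  refine ⟨C * 2 ^ b * ∑' k : Fin d → ℤ, ‖latticeVec k‖ ^ (-b), by positivity,
    fun lam hl x hx => ?_⟩
  have hsum := (h.scale hl hb0).summable hb x
  have hz : latticeVec (0 : Fin d → ℤ) = 0 := by ext j; simp [latticeVec]
  rw [periodization, hsum.tsum_eq_add_tsum_ite 0, hz, add_zero, add_sub_cancel_left]
  -- The series without its term `k = 0` is dominated termwise by a multiple of the full lattice
  -- sum, so the constant depends on neither `lam` nor `x`.
  refine (tsum_of_norm_bounded (hs.hasSum.mul_left
    (Real.sqrt (lam ^ d) * (C * 2 ^ b * lam ^ (-b)))) fun k => ?_).trans (le_of_eq (by ring))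
  split_ifs with hk
  · rw [norm_zero]; positivity
  · rw [GohGoodman.scale, norm_mul, Complex.norm_real, Real.norm_of_nonneg (Real.sqrt_nonneg _),
      mul_assoc]
    gcongr
    exact norm_add_latticeVec_le hC.le hb0 h1 hl hx hk

/-- The tail estimate at `lam = 1` makes the periodization bounded on the cube, which has finite
measure. -/
theorem HasDecay.memLp_periodization (h : HasDecay g b) (hb : (d : ℝ) < b) :
    MemLp (periodization g) 2 (torusMeasure d) := by
  obtain ⟨K, hK, h1⟩ := h.exists_norm_periodization_sub_le hb
  obtain ⟨C, hC, h2⟩ := h.bound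
  have hb0 : 0 < b := (Nat.cast_nonneg d).trans_lt hb
  have hs : GohGoodman.scale g 1 = g := by funext x; simp [GohGoodman.scale]
  refine MemLp.of_bound (h.measurable_periodization hb).aestronglyMeasurable (K + C) ?_
  rw [torusMeasure, ae_restrict_iff' measurableSet_cube]
  refine Eventually.of_forall fun x hx => ?_
  have h3 := h1 1 one_pos x hx
  rw [hs] at h3
  have h4 : ‖g x‖ ≤ C := (h2 x).trans (mul_le_of_le_one_right hC.le
    (Real.rpow_le_one_of_one_le_of_nonpos (by linarith [norm_nonneg x]) (by linarith)))
  have h5 : ‖periodization g x‖ ≤ ‖periodization g x - g x‖ + ‖g x‖ := by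
    simpa using norm_add_le (periodization g x - g x) (g x)
  simp only [one_pow, Real.sqrt_one, Real.one_rpow, one_mul, mul_one] at h3
  linarith

end Decay

/-! ### Unfolding integrals over the torus -/

section Unfolding

variable {d : ℕ}

/-- The lattice translates of the half-open cube partition `ℝᵈ` exactly; countable additivity and
translation invariance do the rest. -/
theorem hasSum_setIntegral_cube {E : Type*} [NormedAddCommGroup E] [NormedSpace ℝ E]
    {h : Rd d → E} (hi : Integrable h) :
    HasSum (fun k : Fin d → ℤ => ∫ x in cube d, h (x + latticeVec k)) (∫ x, h x) := by
  have hneg (k : Fin d → ℤ) : latticeVec (-k) = -latticeVec k := by ext j; simp [latticeVec]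
  let s : (Fin d → ℤ) → Set (Rd d) := fun k => (fun x => x - latticeVec k) ⁻¹' cube d
  have hm (k) : MeasurableSet (s k) := measurableSet_cube.preimage (by fun_prop)
  have hdisj : Pairwise (Function.onFun Disjoint s) := by
    intro k l hkl
    refine Set.disjoint_left.2 fun x hk hl => hkl ?_
    have := eq_of_add_latticeVec_mem_cube (x := x) (k := -k) (l := -l)
      (by rw [hneg, ← sub_eq_add_neg]; exact hk) (by rw [hneg, ← sub_eq_add_neg]; exact hl)
    exact neg_injective this
  have hU : ⋃ k, s k = Set.univ := by
    refine Set.eq_univ_of_forall fun x => ?_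
    obtain ⟨k, hk⟩ := exists_add_latticeVec_mem_cube x
    refine Set.mem_iUnion.2 ⟨-k, ?_⟩
    simpa [s, hneg] using hk
  have key := hasSum_integral_iUnion hm hdisj (f := h) (μ := volume) hi.integrableOn
  rw [hU, setIntegral_univ] at key
  convert! key using 2 with k
  have := (measurePreserving_sub_right volume (latticeVec k)).setIntegral_preimage_emb
    (MeasurableEquiv.subRight (latticeVec k)).measurableEmbedding
    (fun x => h (x + latticeVec k)) (cube d)
  simpa using this.symm

theorem exists_norm_le_of_periodic {φ : Rd d → ℂ} (hc : Continuous φ)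
    (hp : ∀ (k : Fin d → ℤ) (x : Rd d), φ (x + latticeVec k) = φ x) : ∃ M, ∀ x, ‖φ x‖ ≤ M := by
  obtain ⟨M, hM⟩ := (isCompact_closedBall (0 : Rd d) (Real.sqrt d)).exists_bound_of_continuousOn
    hc.continuousOn
  refine ⟨M, fun x => ?_⟩
  obtain ⟨k, hk⟩ := exists_add_latticeVec_mem_cube x
  rw [← hp k x]
  exact hM _ (cube_subset hk)

theorem integrable_mul_of_periodic {g φ : Rd d → ℂ} (hg : Integrable g) (hc : Continuous φ)
    (hp : ∀ (k : Fin d → ℤ) (x : Rd d), φ (x + latticeVec k) = φ x) :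
    Integrable fun x => g x * φ x := by
  obtain ⟨M, hM⟩ := exists_norm_le_of_periodic hc hp
  exact hg.mul_bdd hc.aestronglyMeasurable (Eventually.of_forall hM)

/-- The integral of a periodization against a periodic function unfolds. -/
theorem integral_periodization_mul {g φ : Rd d → ℂ} (hg : Integrable g) (hc : Continuous φ)
    (hp : ∀ (k : Fin d → ℤ) (x : Rd d), φ (x + latticeVec k) = φ x) :
    ∫ x, periodization g x * φ x ∂(torusMeasure d) = ∫ x, g x * φ x := by
  have hi := integrable_mul_of_periodic hg hc hp
  have h1 := hasSum_setIntegral_cube hi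
  have h2 := (hasSum_setIntegral_cube hi.norm).summable
  -- Sum and integral may be exchanged because the same unfolding, applied to the norm of the
  -- product, makes the integrals of the norms summable.
  have h3 := hasSum_integral_of_summable_integral_norm (μ := torusMeasure d)
    (F := fun (k : Fin d → ℤ) x => g (x + latticeVec k) * φ (x + latticeVec k))
    (fun k => (hi.comp_add_right (latticeVec k)).restrict) h2
  rw [← h3.unique h1]
  refine integral_congr_ae (Eventually.of_forall fun x => ?_)
  simp only [hp, periodization, tsum_mul_right]

end Unfolding

/-! ### Values of operators -/

section Graphs

variable {H : Type*} [NormedAddCommGroup H] [InnerProductSpace ℂ H]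
  {A B : H →ₗ.[ℂ] H} {f g h : H}

/-- Operators are handled through their graphs, since one membership statement records both that `f`
is in the domain and what its image is. -/
theorem val_eq_of_mem_graph (hg : (f, g) ∈ A.graph) : val A f = g := by
  obtain ⟨y, rfl, rfl⟩ := (LinearPMap.mem_graph_iff A).1 hg
  rw [val, dif_pos y.2]

theorem mem_graph_opMul (hB : (f, g) ∈ B.graph) (hA : (g, h) ∈ A.graph) :
    (f, h) ∈ (opMul A B).graph := by
  obtain ⟨y, rfl, rfl⟩ := (LinearPMap.mem_graph_iff B).1 hB
  obtain ⟨z, hz, rfl⟩ := (LinearPMap.mem_graph_iff A).1 hA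
  have hyA : B y ∈ A.domain := by
    have := z.2
    rwa [show (z : H) = B y from hz] at this
  have hy : (y : H) ∈ (opMul A B).domain := Submodule.mem_inf.2 ⟨⟨y, hyA, rfl⟩, y.2⟩
  refine (LinearPMap.mem_graph_iff _).2 ⟨⟨y, hy⟩, rfl, ?_⟩
  change A _ = A z
  congr 1
  refine Subtype.ext ?_
  rw [hz]
  exact LinearPMap.domRestrict_apply rfl

theorem mem_graph_sub (hA : (f, g) ∈ A.graph) (hB : (f, h) ∈ B.graph) :
    (f, g - h) ∈ (A - B).graph := by
  obtain ⟨y, rfl, rfl⟩ := (LinearPMap.mem_graph_iff A).1 hA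
  obtain ⟨z, hz, rfl⟩ := (LinearPMap.mem_graph_iff B).1 hB
  obtain ⟨z, hz'⟩ := z
  obtain rfl : z = y := hz
  exact (LinearPMap.mem_graph_iff _).2 ⟨⟨y, y.2, hz'⟩, rfl, rfl⟩

theorem mem_graph_smul (c : ℂ) (hA : (f, g) ∈ A.graph) : (f, c • g) ∈ (c • A).graph := by
  obtain ⟨y, rfl, rfl⟩ := (LinearPMap.mem_graph_iff A).1 hA
  exact (LinearPMap.mem_graph_iff _).2 ⟨y, rfl, rfl⟩

end Graphs

/-! ### Graphs of the multiplication and differentiation operators -/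

section OperatorGraphs

variable {d : ℕ}

theorem mem_graph_mulOp {μ : Measure (Rd d)} {m : Rd d → ℂ} {f g : Lp ℂ 2 μ}
    (h : ∀ᵐ x ∂μ, g x = m x * f x) : (f, g) ∈ (mulOp μ m).graph := by
  have hm : MemLp (fun x => m x * f x) 2 μ := (memLp_congr_ae h).1 (Lp.memLp g)
  refine (LinearPMap.mem_graph_iff _).2 ⟨⟨f, hm⟩, rfl, ?_⟩
  change hm.toLp _ = g
  refine Lp.ext ?_
  filter_upwards [h, hm.coeFn_toLp] with x h1 h2
  rw [h1, h2]

theorem mem_graph_opB {j : Fin d} {f g : L2R d} (h : IsWeakDerivR j f g) :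
    (f, (Complex.I / (2 * Real.pi : ℂ)) • g) ∈ (opB j).graph := by
  refine mem_graph_smul _ ?_
  rw [Submodule.toLinearPMap_graph_eq _ (derivGraphR_functional j)]
  exact h

theorem mem_graph_opBT {j : Fin d} {f g : L2T d} (h : IsWeakDerivT j f g) :
    (f, (Complex.I / (2 * Real.pi : ℂ)) • g) ∈ (opBT j).graph := by
  refine mem_graph_smul _ ?_
  rw [Submodule.toLinearPMap_graph_eq _ (derivGraphT_functional j)]
  exact h

end OperatorGraphs

/-! ### Classical derivatives are weak derivatives -/

section WeakDeriv

variable {d : ℕ} {f : Rd d → ℂ} {b c : ℝ} {j : Fin d}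

/-- Integration by parts against a Schwartz function; the required products are integrable as
products of two `L₂` functions. -/
theorem isWeakDerivR_toLp (hf : ContDiff ℝ 1 f) (h0 : MemLp f 2 volume)
    (h1 : MemLp (fun x => fderiv ℝ f x (stdVec j)) 2 volume) :
    IsWeakDerivR j (h0.toLp f) (h1.toLp _) := by
  ext φ
  have hφ : MemLp φ 2 volume := φ.memLp 2
  have hφ' : MemLp (fun x => fderiv ℝ φ x (stdVec j)) 2 volume := by
    simpa only [← SchwartzMap.lineDerivOp_apply_eq_fderiv] using
      (∂_{stdVec j} φ : 𝓢(Rd d, ℂ)).memLp 2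
  rw [TemperedDistribution.lineDerivOp_apply_apply, Lp.toTemperedDistribution_apply,
    Lp.toTemperedDistribution_apply]
  have e1 : ∫ x, (-∂_{stdVec j} φ : 𝓢(Rd d, ℂ)) x • h0.toLp f x =
      -∫ x, f x * fderiv ℝ φ x (stdVec j) := by
    rw [← integral_neg]
    refine integral_congr_ae ?_
    filter_upwards [h0.coeFn_toLp] with x hx
    rw [hx, smul_eq_mul, mul_comm, ← mul_neg]
    rfl
  have e2 : ∫ x, φ x • h1.toLp _ x = ∫ x, fderiv ℝ f x (stdVec j) * φ x := by
    refine integral_congr_ae ?_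
    filter_upwards [h1.coeFn_toLp] with x hx
    rw [hx, smul_eq_mul, mul_comm]
  rw [e1, e2, integral_mul_fderiv_eq_neg_fderiv_mul_of_integrable, neg_neg]
  · exact h1.integrable_mul hφ
  · exact h0.integrable_mul hφ'
  · exact h0.integrable_mul hφ
  · exact fun x _ => hf.differentiable one_ne_zero x
  · exact fun x _ => φ.differentiableAt

/-- A function differentiable on `ℝᵈ` may be differentiated under the periodization. -/
theorem isWeakDerivT_periodization (hf : ContDiff ℝ 1 f) (h0 : HasDecay f b) (hb : (d : ℝ) < b)
    (h1 : HasDecay (fun x => fderiv ℝ f x (stdVec j)) c) (hc : (d : ℝ) < c) :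
    IsWeakDerivT j ((h0.memLp_periodization hb).toLp _) ((h1.memLp_periodization hc).toLp _) := by
  intro φ hφ
  have hφc : Continuous φ := hφ.1.continuous
  have hφd : Continuous fun x => fderiv ℝ φ x (stdVec j) :=
    (hφ.1.continuous_fderiv (by simp)).clm_apply continuous_const
  have hφp (k : Fin d → ℤ) (x : Rd d) :
      fderiv ℝ φ (x + latticeVec k) (stdVec j) = fderiv ℝ φ x (stdVec j) := by
    rw [← fderiv_comp_add_right]
    simp_rw [hφ.2 k]
  have e1 : ∫ x, (h0.memLp_periodization hb).toLp _ x * fderiv ℝ φ x (stdVec j)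
      ∂(torusMeasure d) = ∫ x, f x * fderiv ℝ φ x (stdVec j) := by
    rw [← integral_periodization_mul (h0.integrable hb) hφd hφp]
    refine integral_congr_ae ?_
    filter_upwards [(h0.memLp_periodization hb).coeFn_toLp] with x hx
    rw [hx]
  have e2 : ∫ x, (h1.memLp_periodization hc).toLp _ x * φ x ∂(torusMeasure d) =
      ∫ x, fderiv ℝ f x (stdVec j) * φ x := by
    rw [← integral_periodization_mul (h1.integrable hc) hφc hφ.2]
    refine integral_congr_ae ?_
    filter_upwards [(h1.memLp_periodization hc).coeFn_toLp] with x hx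
    rw [hx]
  rw [e1, e2]
  -- After unfolding, the integration by parts takes place on `ℝᵈ`, so no boundary of the cube
  -- enters. The products are integrable because periodic test functions and their derivatives are
  -- bounded.
  exact integral_mul_fderiv_eq_neg_fderiv_mul_of_integrable
    (integrable_mul_of_periodic (h1.integrable hc) hφc hφ.2)
    (integrable_mul_of_periodic (h0.integrable hb) hφd hφp)
    (integrable_mul_of_periodic (h0.integrable hb) hφc hφ.2)
    (fun x _ => hf.differentiable one_ne_zero x)
    (fun x _ => hφ.1.differentiable (by simp) x)

/-- The character `x ↦ exp(2πi xⱼ)` of the torus. -/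
def torusChar (j : Fin d) (x : Rd d) : ℂ := Complex.exp (2 * Real.pi * Complex.I * (x j : ℂ))

theorem norm_torusChar (j : Fin d) (x : Rd d) : ‖torusChar j x‖ = 1 := by
  rw [torusChar, show (2 * Real.pi * Complex.I * (x j : ℂ) : ℂ) =
    ((2 * Real.pi * x j : ℝ) : ℂ) * Complex.I by push_cast; ring, Complex.norm_exp_ofReal_mul_I]

theorem contDiff_torusChar (j : Fin d) : ContDiff ℝ ∞ (torusChar j) := by
  have h : ContDiff ℝ ∞ fun x : Rd d => (x j : ℂ) :=
    Complex.ofRealCLM.contDiff.comp (EuclideanSpace.proj (𝕜 := ℝ) j).contDiff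
  exact (contDiff_const.mul h).cexp

theorem torusChar_add_latticeVec (j : Fin d) (k : Fin d → ℤ) (x : Rd d) :
    torusChar j (x + latticeVec k) = torusChar j x := by
  rw [torusChar, torusChar, Complex.exp_eq_exp_iff_exists_int]
  refine ⟨k j, ?_⟩
  rw [PiLp.add_apply, latticeVec_apply]
  push_cast
  ring

theorem fderiv_torusChar (j : Fin d) (x : Rd d) :
    fderiv ℝ (torusChar j) x (stdVec j) = 2 * Real.pi * Complex.I * torusChar j x := by
  have h : HasFDerivAt (fun x : Rd d => (x j : ℂ))
      (Complex.ofRealCLM.comp (EuclideanSpace.proj (𝕜 := ℝ) j)) x :=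
    (Complex.ofRealCLM.comp (EuclideanSpace.proj (𝕜 := ℝ) j)).hasFDerivAt
  have h2 := (h.const_mul (2 * Real.pi * Complex.I : ℂ)).cexp
  have h3 : HasFDerivAt (torusChar j) _ x := h2
  rw [h3.fderiv]
  simp [stdVec, torusChar]
  ring

theorem isPeriodicTest_torusChar_mul {φ : Rd d → ℂ} (hφ : IsPeriodicTest φ) (j : Fin d) :
    IsPeriodicTest fun x => torusChar j x * φ x :=
  ⟨(contDiff_torusChar j).mul hφ.1, fun k x => by
    simp only [torusChar_add_latticeVec, hφ.2]⟩

theorem memLp_torusChar_mul (j : Fin d) (F : L2T d) :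
    MemLp (fun x => torusChar j x * F x) 2 (torusMeasure d) :=
  (Lp.memLp F).of_le_mul (c := 1)
    ((contDiff_torusChar j).continuous.aestronglyMeasurable.mul (Lp.aestronglyMeasurable F))
    (Eventually.of_forall fun x => by rw [norm_mul, norm_torusChar])

/-- Multiplication of an element of `L₂(𝕋ᵈ)` by the character `exp(2πi xⱼ)`. -/
def charMul (j : Fin d) (F : L2T d) : L2T d := (memLp_torusChar_mul j F).toLp _

theorem coeFn_charMul (j : Fin d) (F : L2T d) :
    ∀ᵐ x ∂(torusMeasure d), charMul j F x = torusChar j x * F x :=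
  (memLp_torusChar_mul j F).coeFn_toLp

theorem mem_graph_opAT (j : Fin d) (F : L2T d) : (F, charMul j F) ∈ (opAT j).graph :=
  mem_graph_mulOp (coeFn_charMul j F)

theorem integral_charMul_mul (F : L2T d) (φ : Rd d → ℂ) :
    ∫ x, charMul j F x * φ x ∂(torusMeasure d) =
      ∫ x, F x * (torusChar j x * φ x) ∂(torusMeasure d) := by
  refine integral_congr_ae ?_
  filter_upwards [coeFn_charMul j F] with x hx
  rw [hx]; ring

/-- The product rule for a weakly differentiable function and the character `exp(2πi xⱼ)`. -/
theorem IsWeakDerivT.charMul {F G : L2T d} (h : IsWeakDerivT j F G) :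
    IsWeakDerivT j (charMul j F)
      ((2 * Real.pi * Complex.I : ℂ) • charMul j F + charMul j G) := by
  intro φ hφ
  have hφc : Continuous φ := hφ.1.continuous
  have hφd : Continuous fun x => fderiv ℝ φ x (stdVec j) :=
    (hφ.1.continuous_fderiv (by simp)).clm_apply continuous_const
  have hec := (contDiff_torusChar j).continuous
  have hc1 : Continuous fun x => torusChar j x * fderiv ℝ φ x (stdVec j) := hec.mul hφd
  have hc2 : Continuous fun x => torusChar j x * φ x := hec.mul hφc
  have hc3 : Continuous fun x => 2 * Real.pi * Complex.I * (torusChar j x * φ x) :=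
    continuous_const.mul hc2
  -- The character is itself smooth and periodic, so it can be moved onto the test function.
  have key := h _ (isPeriodicTest_torusChar_mul hφ j)
  have hd (x : Rd d) : fderiv ℝ (fun x => torusChar j x * φ x) x (stdVec j) =
      torusChar j x * fderiv ℝ φ x (stdVec j) +
        2 * Real.pi * Complex.I * (torusChar j x * φ x) := by
    rw [fderiv_fun_mul ((contDiff_torusChar j).differentiable (by simp) x)
      (hφ.1.differentiable (by simp) x)]
    simp only [add_apply, smul_apply, fderiv_torusChar,
      smul_eq_mul]
    ring
  simp only [hd, mul_add] at key
  rw [integral_add (integrable_torus F hc1) (integrable_torus F hc3)] at key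
  have e1 : ∫ x, ((2 * Real.pi * Complex.I : ℂ) • GohGoodman.charMul j F +
      GohGoodman.charMul j G : L2T d) x * φ x ∂(torusMeasure d) =
      ∫ x, F x * (2 * Real.pi * Complex.I * (torusChar j x * φ x)) ∂(torusMeasure d) +
        ∫ x, G x * (torusChar j x * φ x) ∂(torusMeasure d) := by
    rw [← integral_add (integrable_torus F hc3) (integrable_torus G hc2)]
    refine integral_congr_ae ?_
    filter_upwards [coeFn_charMul j F, coeFn_charMul j G,
      Lp.coeFn_add ((2 * Real.pi * Complex.I : ℂ) • GohGoodman.charMul j F)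
        (GohGoodman.charMul j G),
      Lp.coeFn_smul (2 * Real.pi * Complex.I : ℂ) (GohGoodman.charMul j F)] with x h1 h2 h3 h4
    rw [h3, Pi.add_apply, h4, Pi.smul_apply, h1, h2, smul_eq_mul]
    ring
  rw [e1, integral_charMul_mul]
  linear_combination key

theorem charMul_smul (c : ℂ) (F : L2T d) : charMul j (c • F) = c • charMul j F := by
  refine Lp.ext ?_
  filter_upwards [coeFn_charMul j F, coeFn_charMul j (c • F), Lp.coeFn_smul c F,
    Lp.coeFn_smul c (charMul j F)] with x h1 h2 h3 h4
  rw [h2, h3, h4, Pi.smul_apply, Pi.smul_apply, h1, smul_eq_mul, smul_eq_mul]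
  ring

/-- The commutator `[A_j, B_j]` acts as multiplication by `exp(2πi xⱼ)`. -/
theorem mem_graph_commutator {F G : L2T d} (h : IsWeakDerivT j F G) :
    (F, charMul j F) ∈ (commutator (opAT j) (opBT j)).graph := by
  have h1 := mem_graph_opMul (mem_graph_opBT h) (mem_graph_opAT j _)
  have h2 := mem_graph_opMul (mem_graph_opAT j F) (mem_graph_opBT h.charMul)
  have h3 := mem_graph_sub h1 h2
  convert! h3 using 2
  have hpi : (Real.pi : ℂ) ≠ 0 := by exact_mod_cast Real.pi_ne_zero
  -- The derivative terms cancel; what remains of the product rule has coefficient `-(i / 2π)(2πi) =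
  -- 1`.
  rw [charMul_smul, smul_add, sub_add_cancel_right, smul_smul, ← neg_smul]
  rw [show -(Complex.I / (2 * Real.pi : ℂ) * (2 * Real.pi * Complex.I)) = 1 by
    field_simp
    simp, one_smul]

end WeakDeriv

/-! ### Rescaling functions on the torus to functions on `ℝᵈ` -/

section Dilate

variable {d : ℕ} {lam : ℝ}

/-- The function `x ↦ lam^(-d/2) F(x / lam)` on the dilated cube `lam • cube`, extended by `0`. -/
def dilateFun (lam : ℝ) (F : Rd d → ℂ) (x : Rd d) : ℂ :=
  ((Real.sqrt (lam ^ d))⁻¹ : ℝ) * (cube d).indicator F (lam⁻¹ • x)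

theorem memLp_dilateFun (hl : 0 < lam) {F : Rd d → ℂ} (hF : MemLp F 2 (torusMeasure d)) :
    MemLp (dilateFun lam F) 2 volume := by
  have hi : MemLp ((cube d).indicator F) 2 volume := (memLp_indicator_iff_restrict
    measurableSet_cube).2 hF
  -- Dilations pull null sets back to null sets, so a.e. strong measurability survives the
  -- composition.
  have hq : Measure.QuasiMeasurePreserving (fun x : Rd d => lam⁻¹ • x) volume volume := by
    refine ⟨measurable_const_smul _, ?_⟩
    rw [Measure.map_addHaar_smul _ (inv_ne_zero hl.ne')]
    exact Measure.smul_absolutelyContinuous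
  have hm := hi.1.comp_quasiMeasurePreserving hq
  refine MemLp.const_mul ?_ _
  refine (memLp_two_iff_integrable_sq_norm hm).2 ?_
  exact (((memLp_two_iff_integrable_sq_norm hi.1).1 hi).comp_smul (inv_ne_zero hl.ne'))

open scoped Classical in
/-- The rescaling `L₂(𝕋ᵈ) → L₂(ℝᵈ)`; only used for `lam > 0`. -/
def dilate (lam : ℝ) (F : L2T d) : L2R d :=
  if h : MemLp (dilateFun lam F) 2 volume then h.toLp _ else 0

theorem coeFn_dilate (hl : 0 < lam) (F : L2T d) :
    dilate lam F =ᵐ[volume] dilateFun lam F := by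
  have h := memLp_dilateFun hl (Lp.memLp F)
  rw [dilate, dif_pos h]
  exact h.coeFn_toLp

/-- The two normalizing factors multiply to `(lam ^ d)⁻¹`, which cancels the Jacobian of the
dilation. -/
theorem inner_dilate (hl : 0 < lam) (F G : L2T d) :
    inner ℂ (dilate lam F) (dilate lam G) = inner ℂ F G := by
  rw [L2.inner_def, L2.inner_def]
  have e1 : ∫ x, inner ℂ (dilate lam F x) (dilate lam G x) =
      ∫ x, ((lam ^ d)⁻¹ : ℝ) • (cube d).indicator (fun y => inner ℂ (F y) (G y)) (lam⁻¹ • x) := by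
    refine integral_congr_ae ?_
    filter_upwards [coeFn_dilate hl F, coeFn_dilate hl G] with x h1 h2
    rw [h1, h2, dilateFun, dilateFun]
    by_cases hx : lam⁻¹ • x ∈ cube d
    · simp only [Set.indicator_of_mem hx, RCLike.inner_apply, map_mul, Complex.conj_ofReal,
        Complex.real_smul]
      have : ((lam ^ d)⁻¹ : ℝ) = (Real.sqrt (lam ^ d))⁻¹ * (Real.sqrt (lam ^ d))⁻¹ := by
        rw [← mul_inv, Real.mul_self_sqrt (by positivity)]
      rw [this]
      push_cast
      ring
    · simp [Set.indicator_of_notMem hx]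
  change _ = ∫ x in cube d, inner ℂ (F x) (G x)
  rw [e1, integral_smul, Measure.integral_comp_inv_smul,
    integral_indicator measurableSet_cube, finrank_euclideanSpace_fin,
    abs_of_pos (by positivity), smul_smul, inv_mul_cancel₀ (by positivity), one_smul]

theorem norm_dilate (hl : 0 < lam) (F : L2T d) : ‖dilate lam F‖ = ‖F‖ := by
  rw [@norm_eq_sqrt_re_inner ℂ, @norm_eq_sqrt_re_inner ℂ _ _ _ _ F, inner_dilate hl]

theorem coeFn_dilate_of_ae (hl : 0 < lam) {F : L2T d} {G : Rd d → ℂ}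
    (h : ∀ᵐ x ∂(torusMeasure d), F x = G x) : dilate lam F =ᵐ[volume] dilateFun lam G := by
  have hq : Measure.QuasiMeasurePreserving (fun x : Rd d => lam⁻¹ • x) volume volume := by
    refine ⟨measurable_const_smul _, ?_⟩
    rw [Measure.map_addHaar_smul _ (inv_ne_zero hl.ne')]
    exact Measure.smul_absolutelyContinuous
  replace h := (ae_restrict_iff' measurableSet_cube).1 h
  filter_upwards [coeFn_dilate hl F, hq.ae h] with x h1 h2
  rw [h1, dilateFun, dilateFun]
  by_cases hx : lam⁻¹ • x ∈ cube d
  · rw [Set.indicator_of_mem hx, Set.indicator_of_mem hx, h2 hx]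
  · rw [Set.indicator_of_notMem hx, Set.indicator_of_notMem hx]

theorem cube_mem_nhds : cube d ∈ 𝓝 (0 : Rd d) := by
  have h : ∀ᶠ x : Rd d in 𝓝 0, ∀ j, x j ∈ Set.Ico (-1 / 2 : ℝ) (1 / 2) := by
    refine eventually_all.2 fun j => ?_
    have hc : Continuous fun x : Rd d => x j := by fun_prop
    refine hc.continuousAt.eventually_mem (Ico_mem_nhds ?_ ?_) <;> (simp; try norm_num)
  exact h

/-- The origin is interior to the cube, so the dilated cubes exhaust `ℝᵈ` and cutting off to them is
invisible in pointwise limits. -/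
theorem eventually_inv_smul_mem_cube (x : Rd d) : ∀ᶠ lam : ℝ in atTop, lam⁻¹ • x ∈ cube d := by
  have h : Tendsto (fun lam : ℝ => lam⁻¹ • x) atTop (𝓝 0) := by
    simpa using (tendsto_inv_atTop_zero (𝕜 := ℝ)).smul_const x
  exact h.eventually_mem cube_mem_nhds

end Dilate

/-- Dominated convergence in `L₂`. -/
theorem tendsto_eLpNorm_two_of_dominated {α : Type*} [MeasurableSpace α] {μ : Measure α}
    {ι : Type*} {l : Filter ι} [l.IsCountablyGenerated] {v : ι → α → ℂ} {bound : α → ℝ}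
    (hm : ∀ᶠ i in l, Measurable (v i)) (hb : MemLp bound 2 μ)
    (hv : ∀ᶠ i in l, ∀ᵐ x ∂μ, ‖v i x‖ ≤ bound x)
    (hlim : ∀ᵐ x ∂μ, Tendsto (fun i => v i x) l (𝓝 0)) :
    Tendsto (fun i => eLpNorm (v i) 2 μ) l (𝓝 0) := by
  simp only [eLpNorm_eq_lintegral_rpow_enorm_toReal two_ne_zero ENNReal.ofNat_ne_top]
  have h : Tendsto (fun i => ∫⁻ x, ‖v i x‖ₑ ^ (2 : ENNReal).toReal ∂μ) l (𝓝 (∫⁻ _, 0 ∂μ)) := by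
    refine tendsto_lintegral_filter_of_dominated_convergence
      (fun x => ‖bound x‖ₑ ^ (2 : ENNReal).toReal) ?_ ?_ ?_ ?_
    · filter_upwards [hm] with i hi using hi.enorm.pow_const _
    · filter_upwards [hv] with i hi
      filter_upwards [hi] with x hx
      gcongr
      exact enorm_le_iff_norm_le.2 (hx.trans (Real.le_norm_self _))
    · exact (lintegral_rpow_enorm_lt_top_of_eLpNorm_lt_top two_ne_zero ENNReal.ofNat_ne_top
        hb.2).ne
    · filter_upwards [hlim] with x hx
      have := ((ENNReal.continuous_rpow_const (y := (2 : ENNReal).toReal)).tendsto _).comp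
        hx.enorm
      simpa [Function.comp_def] using this
  rw [lintegral_zero] at h
  have := ((ENNReal.continuous_rpow_const (y := 1 / (2 : ENNReal).toReal)).tendsto _).comp h
  simpa [Function.comp_def] using this

/-! ### The main convergence result for dilated periodizations -/

section Convergence

variable {d : ℕ} {g : Rd d → ℂ} {b : ℝ}

/-- Convergence of rescaled weighted periodizations: the tails of the periodization are
negligible and the main term converges dominatedly. -/
theorem tendsto_dilate (hg : HasDecay g b) (hb : (d : ℝ) < b) {a : ℝ → Rd d → ℂ} {h : Rd d → ℂ}
    (hhm : Measurable h) (hh : MemLp h 2 volume) {F : ℝ → L2T d} {bound : Rd d → ℝ} {s A : ℝ} (hA : 0 ≤ A)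
    (hF : ∀ lam > 0, ∀ᵐ x ∂(torusMeasure d),
      F lam x = a lam x * periodization (scale g lam) x)
    (ha : ∀ lam, Measurable (a lam)) (haA : ∀ lam > 0, ∀ x, ‖a lam x‖ ≤ A * lam ^ s)
    (hs : s + d / 2 < b) (hbd : MemLp bound 2 volume)
    (hbound : ∀ lam > 0, ∀ x, ‖a lam (lam⁻¹ • x) * g x‖ ≤ bound x)
    (hlim : ∀ x, Tendsto (fun lam => a lam (lam⁻¹ • x) * g x) atTop (𝓝 (h x))) :
    Tendsto (fun lam => dilate lam (F lam)) atTop (𝓝 (hh.toLp h)) := by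
  obtain ⟨K, hK, hKb⟩ := hg.exists_norm_periodization_sub_le hb
  refine Lp.tendsto_Lp_of_tendsto_eLpNorm _ hh ?_
  let S (lam : ℝ) : Set (Rd d) := (fun x => lam⁻¹ • x) ⁻¹' cube d
  have hS (lam : ℝ) : MeasurableSet (S lam) :=
    measurableSet_cube.preimage (measurable_const_smul _)
  have hgm : Measurable g := hg.continuous.measurable
  have ham (lam : ℝ) : Measurable fun x => a lam (lam⁻¹ • x) :=
    (ha lam).comp (measurable_const_smul _)
  -- The error splits in two: `v` compares the cut-off main term with the limit, and `u` collects
  -- the weighted contributions of `k ≠ 0`.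
  let v (lam : ℝ) (x : Rd d) : ℂ := (S lam).indicator (fun x => a lam (lam⁻¹ • x) * g x) x - h x
  let u (lam : ℝ) (x : Rd d) : ℂ := (S lam).indicator (fun x => a lam (lam⁻¹ • x) *
    (((Real.sqrt (lam ^ d))⁻¹ : ℝ) *
      (periodization (scale g lam) (lam⁻¹ • x) - scale g lam (lam⁻¹ • x)))) x
  have hv : Tendsto (fun lam => eLpNorm (v lam) 2 volume) atTop (𝓝 0) := by
    refine tendsto_eLpNorm_two_of_dominated (bound := fun x => bound x + ‖h x‖) ?_
      (hbd.add hh.norm) ?_ ?_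
    · exact Eventually.of_forall fun lam =>
        (((ham lam).mul hgm).indicator (hS lam)).sub hhm
    · filter_upwards [eventually_gt_atTop 0] with lam hl
      refine Eventually.of_forall fun x => (norm_sub_le _ _).trans ?_
      gcongr
      exact (norm_indicator_le_norm_self _ _).trans (hbound lam hl x)
    · refine Eventually.of_forall fun x => ?_
      rw [← sub_self (h x)]
      refine ((hlim x).congr' ?_).sub_const _
      filter_upwards [eventually_inv_smul_mem_cube x] with lam hx
      rw [Set.indicator_of_mem (show x ∈ S lam from hx)]
  have hu : Tendsto (fun lam => eLpNorm (u lam) 2 volume) atTop (𝓝 0) := by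
    have hV : volume (cube d) ≠ ⊤ := (measure_mono cube_subset).trans_lt
      measure_closedBall_lt_top |>.ne
    -- The exponent adds `s` from the weight, `-b` from the uniform tail bound and `d / 2` from the
    -- square root of the volume of the dilated cube.
    have hlim0 : Tendsto (fun lam : ℝ => ENNReal.ofReal
        (A * K * lam ^ (s + d / 2 - b)) * volume (cube d) ^ (1 / (2 : ℝ))) atTop (𝓝 0) := by
      have h1 : Tendsto (fun lam : ℝ => A * K * lam ^ (s + d / 2 - b)) atTop (𝓝 0) := by
        have := (tendsto_rpow_neg_atTop (y := b - (s + d / 2)) (by linarith)).const_mul (A * K)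
        simpa using this
      have h2 := ENNReal.Tendsto.mul_const (b := volume (cube d) ^ (1 / (2 : ℝ)))
        (ENNReal.tendsto_ofReal h1) (Or.inr (ENNReal.rpow_ne_top_of_nonneg (by norm_num) hV))
      simpa using h2
    refine tendsto_of_tendsto_of_tendsto_of_le_of_le' tendsto_const_nhds hlim0
      (Eventually.of_forall fun _ => zero_le) ?_
    filter_upwards [eventually_gt_atTop 0] with lam hl
    have hc : 0 ≤ A * K * lam ^ (s - b) := by positivity
    have hsq : 0 < Real.sqrt (lam ^ d) := by positivity
    calc eLpNorm (u lam) 2 volume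
        ≤ eLpNorm ((S lam).indicator fun _ => A * K * lam ^ (s - b)) 2 volume := by
          refine eLpNorm_mono fun x => ?_
          by_cases hx : x ∈ S lam
          · simp only [u, Set.indicator_of_mem hx]
            rw [Real.norm_of_nonneg hc, norm_mul, norm_mul, Complex.norm_real,
              Real.norm_of_nonneg (by positivity)]
            calc _ ≤ (A * lam ^ s) * ((Real.sqrt (lam ^ d))⁻¹ *
                  (Real.sqrt (lam ^ d) * (K * lam ^ (-b)))) := by
                  gcongr
                  · exact haA lam hl _
                  · exact hKb lam hl _ hx
              _ = A * K * lam ^ (s - b) := by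
                  rw [sub_eq_add_neg, Real.rpow_add hl, inv_mul_cancel_left₀ hsq.ne']
                  ring
          · simp [u, Set.indicator_of_notMem hx]
      _ = ENNReal.ofReal (A * K * lam ^ (s + d / 2 - b)) * volume (cube d) ^ (1 / (2 : ℝ)) := by
          rw [eLpNorm_indicator_const (hS lam) two_ne_zero ENNReal.ofNat_ne_top,
            Measure.addHaar_preimage_smul _ (inv_ne_zero hl.ne'), finrank_euclideanSpace_fin,
            inv_pow, inv_inv, abs_of_pos (by positivity), ENNReal.toReal_ofNat,
            ENNReal.mul_rpow_of_nonneg _ _ (by norm_num), ← mul_assoc,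
            Real.enorm_of_nonneg hc, ENNReal.ofReal_rpow_of_nonneg (by positivity) (by norm_num),
            ← ENNReal.ofReal_mul hc]
          congr 2
          rw [← Real.rpow_natCast, ← Real.rpow_mul hl.le, mul_assoc, ← Real.rpow_add hl]
          ring_nf
  have huv : Tendsto (fun lam => eLpNorm (u lam) 2 volume + eLpNorm (v lam) 2 volume) atTop
      (𝓝 0) := by simpa using hu.add hv
  refine tendsto_of_tendsto_of_tendsto_of_le_of_le' tendsto_const_nhds huv
    (Eventually.of_forall fun _ => zero_le) ?_
  filter_upwards [eventually_gt_atTop 0] with lam hl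
  have hb0 : 0 < b := (Nat.cast_nonneg d).trans_lt hb
  have hsc := hg.scale hl hb0
  have hsq : 0 < Real.sqrt (lam ^ d) := by positivity
  have hae : (dilate lam (F lam) : Rd d → ℂ) - h =ᵐ[volume] u lam + v lam := by
    filter_upwards [coeFn_dilate_of_ae hl (hF lam hl)] with x hx
    rw [Pi.sub_apply, Pi.add_apply, hx, dilateFun]
    by_cases hxS : x ∈ S lam
    · simp only [u, v, Set.indicator_of_mem hxS]
      rw [Set.indicator_of_mem (show lam⁻¹ • x ∈ cube d from hxS)]
      have e : ((Real.sqrt (lam ^ d))⁻¹ : ℝ) * scale g lam (lam⁻¹ • x) = g x := by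
        rw [scale, smul_inv_smul₀ hl.ne', ← mul_assoc, ← Complex.ofReal_mul,
          inv_mul_cancel₀ hsq.ne', Complex.ofReal_one, one_mul]
      linear_combination a lam (lam⁻¹ • x) * e
    · simp only [u, v, Set.indicator_of_notMem hxS]
      rw [Set.indicator_of_notMem (show lam⁻¹ • x ∉ cube d from hxS)]
      ring
  rw [eLpNorm_congr_ae hae]
  refine eLpNorm_add_le ?_ ?_ one_le_two
  · refine Measurable.aestronglyMeasurable (Measurable.indicator ?_ (hS lam))
    exact (ham lam).mul (measurable_const.mul
      (((hsc.measurable_periodization hb).comp (measurable_const_smul _)).sub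
        (hsc.continuous.measurable.comp (measurable_const_smul _))))
  · exact (((ham lam).mul hgm).indicator (hS lam)).aestronglyMeasurable.sub hh.1

end Convergence

/-! ### Variances of vectors -/

section VecVariance

variable {H K : Type*} [NormedAddCommGroup H] [InnerProductSpace ℂ H]
  [NormedAddCommGroup K] [InnerProductSpace ℂ K]

/-- The squared distance of `g` to the line spanned by `f`; the variance of an operator `A` at
`f` is the case `g = A f`. -/
def vecVariance (f g : H) : ℝ := ‖g‖ ^ 2 - ‖inner ℂ f g‖ ^ 2 / ‖f‖ ^ 2

theorem variance_eq_vecVariance {A : H →ₗ.[ℂ] H} {f g : H} (h : (f, g) ∈ A.graph) :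
    variance A f = vecVariance f g := by
  rw [variance, val_eq_of_mem_graph h, vecVariance]

theorem vecVariance_smul (f g : H) (c : ℂ) :
    vecVariance f (c • g) = ‖c‖ ^ 2 * vecVariance f g := by
  simp only [vecVariance, norm_smul, inner_smul_right, norm_mul]
  ring

/-- Translating along the line spanned by `f` does not change the distance to it. This permits
subtracting `1` from the character before rescaling. For `f = 0` the quotient is `0 / 0 = 0` on both
sides. -/
theorem vecVariance_add_self (f e : H) : vecVariance f (f + e) = vecVariance f e := by
  rcases eq_or_ne f 0 with rfl | hf
  · simp [vecVariance]
  have hf' : ‖f‖ ≠ 0 := norm_ne_zero_iff.2 hf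
  have h1 : ‖f + e‖ ^ 2 = ‖f‖ ^ 2 + 2 * (inner ℂ f e).re + ‖e‖ ^ 2 := norm_add_sq (𝕜 := ℂ) f e
  have h2 : ‖inner ℂ f (f + e)‖ ^ 2 =
      ‖f‖ ^ 4 + 2 * ‖f‖ ^ 2 * (inner ℂ f e).re + ‖inner ℂ f e‖ ^ 2 := by
    rw [inner_add_right, inner_self_eq_norm_sq_to_K, ← Complex.normSq_eq_norm_sq,
      ← Complex.normSq_eq_norm_sq, Complex.normSq_apply, Complex.normSq_apply]
    have e1 : (((‖f‖ : ℂ)) ^ 2).re = ‖f‖ ^ 2 := by rw [← Complex.ofReal_pow, Complex.ofReal_re]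
    have e2 : (((‖f‖ : ℂ)) ^ 2).im = 0 := by rw [← Complex.ofReal_pow, Complex.ofReal_im]
    simp only [Complex.add_re, Complex.add_im, Complex.coe_algebraMap, e1, e2]
    ring
  rw [vecVariance, vecVariance, h1, h2]
  field_simp
  ring

theorem vecVariance_of_inner_eq {f g : H} {f' g' : K} (hf : ‖f‖ = ‖f'‖) (hg : ‖g‖ = ‖g'‖)
    (h : inner ℂ f g = inner ℂ f' g') : vecVariance f g = vecVariance f' g' := by
  rw [vecVariance, vecVariance, hf, hg, h]

theorem tendsto_vecVariance {ι : Type*} {l : Filter ι} {u w : ι → H} {f g : H} (hf : f ≠ 0)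
    (hu : Tendsto u l (𝓝 f)) (hw : Tendsto w l (𝓝 g)) :
    Tendsto (fun i => vecVariance (u i) (w i)) l (𝓝 (vecVariance f g)) :=
  (hw.norm.pow 2).sub (((hu.inner hw).norm.pow 2).div (hu.norm.pow 2)
    (pow_ne_zero 2 (norm_ne_zero_iff.2 hf)))

end VecVariance

/-- The variance depends only on norms and one inner product, all preserved by `dilate`, so torus
variances have the limit found on `ℝᵈ`. -/
theorem tendsto_vecVariance_of_dilate {d : ℕ} {F G : ℝ → L2T d} {f g : L2R d} (hf : f ≠ 0)
    (hF : Tendsto (fun lam => dilate lam (F lam)) atTop (𝓝 f))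
    (hG : Tendsto (fun lam => dilate lam (G lam)) atTop (𝓝 g)) :
    Tendsto (fun lam => vecVariance (F lam) (G lam)) atTop (𝓝 (vecVariance f g)) := by
  refine (tendsto_vecVariance hf hF hG).congr' ?_
  filter_upwards [eventually_gt_atTop 0] with lam hl
  exact vecVariance_of_inner_eq (norm_dilate hl _) (norm_dilate hl _) (inner_dilate hl _ _)

/-! ### The operators at periodized scaled functions -/

section ScaledPer

variable {d : ℕ} {f : Rd d → ℂ} {b c lam : ℝ} {j : Fin d}

theorem memLp_periodization_scale (h : HasDecay f b) (hb : (d : ℝ) < b) (hl : 0 < lam) :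
    MemLp (periodization (scale f lam)) 2 (torusMeasure d) :=
  (h.scale hl ((Nat.cast_nonneg d).trans_lt hb)).memLp_periodization hb

theorem scaledPer_eq (h : HasDecay f b) (hb : (d : ℝ) < b) (hl : 0 < lam) :
    scaledPer f lam = (memLp_periodization_scale h hb hl).toLp _ := by
  rw [scaledPer, toL2T, dif_pos (memLp_periodization_scale h hb hl)]

theorem coeFn_scaledPer (h : HasDecay f b) (hb : (d : ℝ) < b) (hl : 0 < lam) :
    ∀ᵐ x ∂(torusMeasure d), scaledPer f lam x = periodization (scale f lam) x := by
  rw [scaledPer_eq h hb hl]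
  exact (memLp_periodization_scale h hb hl).coeFn_toLp

theorem fderiv_scale (hf : ContDiff ℝ 1 f) (x v : Rd d) :
    fderiv ℝ (scale f lam) x v = lam * scale (fun y => fderiv ℝ f y v) lam x := by
  have h1 : HasFDerivAt (fun x : Rd d => lam • x) (lam • ContinuousLinearMap.id ℝ (Rd d)) x :=
    (hasFDerivAt_id x).const_smul lam
  have h2 := ((hf.differentiable one_ne_zero (lam • x)).hasFDerivAt.comp x h1).const_mul
    (Real.sqrt (lam ^ d) : ℂ)
  have h3 : HasFDerivAt (scale f lam) _ x := h2
  rw [h3.fderiv, scale]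
  simp
  ring

/-- The factor `lam` is the chain rule; periodization is linear and lets it through. -/
theorem isWeakDerivT_scaledPer (hf : ContDiff ℝ 1 f) (h0 : HasDecay f b) (hb : (d : ℝ) < b)
    (h1 : HasDecay (fun x => fderiv ℝ f x (stdVec j)) c) (hc : (d : ℝ) < c) (hl : 0 < lam) :
    IsWeakDerivT j (scaledPer f lam)
      ((lam : ℂ) • scaledPer (fun x => fderiv ℝ f x (stdVec j)) lam) := by
  have hb0 : 0 < b := (Nat.cast_nonneg d).trans_lt hb
  have hc0 : 0 < c := (Nat.cast_nonneg d).trans_lt hc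
  have hsc : ContDiff ℝ 1 (scale f lam) :=
    contDiff_const.mul (hf.comp (contDiff_const_smul lam))
  have hd : (fun x => fderiv ℝ (scale f lam) x (stdVec j)) =
      fun x => (lam : ℂ) * scale (fun y => fderiv ℝ f y (stdVec j)) lam x :=
    funext fun x => fderiv_scale hf x _
  have h1' : HasDecay (fun x => fderiv ℝ (scale f lam) x (stdVec j)) c := by
    obtain ⟨hcont, C, hC, hC'⟩ := h1.scale hl hc0
    rw [hd]
    refine ⟨continuous_const.mul hcont, lam * C, by positivity, fun x => ?_⟩
    rw [norm_mul, Complex.norm_real, Real.norm_of_nonneg hl.le, mul_assoc]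
    gcongr
    exact hC' x
  have key := isWeakDerivT_periodization hsc (h0.scale hl hb0) hb h1' hc
  rw [scaledPer_eq h0 hb hl]
  convert! key using 1
  refine Lp.ext ?_
  filter_upwards [coeFn_scaledPer h1 hc hl, (h1'.memLp_periodization hc).coeFn_toLp,
    Lp.coeFn_smul (lam : ℂ) (scaledPer (fun x => fderiv ℝ f x (stdVec j)) lam)] with x e1 e2 e3
  rw [e3, Pi.smul_apply, e1, e2, hd, smul_eq_mul, periodization, periodization, tsum_mul_left]

theorem tendsto_dilate_scaledPer (h : HasDecay f b) (hb : (d : ℝ) < b) (hf : MemLp f 2 volume) :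
    Tendsto (fun lam => dilate lam (scaledPer f lam)) atTop (𝓝 (hf.toLp f)) := by
  have hd0 : (0 : ℝ) ≤ d := Nat.cast_nonneg d
  refine tendsto_dilate (a := fun _ _ => 1) (s := 0) (A := 1) (bound := fun x => ‖f x‖) h hb
    h.continuous.measurable hf zero_le_one (fun lam hl => ?_) (fun _ => measurable_const)
    (fun lam _ x => by simp) (by linarith) hf.norm (fun lam _ x => by simp) (fun x => by simp)
  simpa only [one_mul] using coeFn_scaledPer h hb hl

/-- This is the difference quotient at `0` of `t ↦ exp(z t)`, taken along `t = lam⁻¹`. -/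
theorem tendsto_mul_exp_sub_one (z : ℂ) :
    Tendsto (fun lam : ℝ => (lam : ℂ) * (Complex.exp (z * (lam⁻¹ : ℝ)) - 1)) atTop (𝓝 z) := by
  have h1 : HasDerivAt (fun t : ℝ => Complex.exp (z * t)) z 0 := by
    have := (((hasDerivAt_id (0 : ℝ)).ofReal_comp).const_mul z).cexp
    simpa using this
  have h2 := h1.tendsto_slope_zero.comp
    (tendsto_inv_atTop_nhdsGT_zero.mono_right (nhdsWithin_mono 0 fun x hx => ne_of_gt hx))
  simpa [Function.comp_def] using h2

theorem torusChar_inv_smul (x : Rd d) : torusChar j (lam⁻¹ • x) =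
    Complex.exp ((2 * Real.pi * Complex.I * x j) * (lam⁻¹ : ℝ)) := by
  rw [torusChar, PiLp.smul_apply, smul_eq_mul, Complex.ofReal_mul]
  ring_nf

/-- The rescaled functions `lam (exp(2πi xⱼ) - 1) f_lam^per` converge to `2πi xⱼ f`. -/
theorem tendsto_dilate_charMul_sub (h : HasDecay f b) (hb : (d : ℝ) < b)
    (hb' : (d : ℝ) / 2 + 1 < b)
    (hx : MemLp (fun x => (2 * Real.pi * Complex.I * x j : ℂ) * f x) 2 volume) :
    Tendsto (fun lam : ℝ => dilate lam
      ((lam : ℂ) • (charMul j (scaledPer f lam) - scaledPer f lam))) atTop (𝓝 (hx.toLp _)) := by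
  -- The crude bound `|exp(iθ) - 1| ≤ 2` controls the tails and requires `1 + d/2 < b`; the sharper
  -- `|exp(iθ) - 1| ≤ |θ|` supplies the dominating function.
  refine tendsto_dilate (a := fun lam x => (lam : ℂ) * (torusChar j x - 1)) (s := 1) (A := 2)
    (bound := fun x => ‖(2 * Real.pi * Complex.I * x j : ℂ) * f x‖) h hb ?_ hx zero_le_two
    (fun lam hl => ?_) (fun lam => ?_) (fun lam hl x => ?_) (by linarith) hx.norm
    (fun lam hl x => ?_) (fun x => ?_)
  · refine Measurable.mul ?_ h.continuous.measurable
    exact measurable_const.mul (Complex.measurable_ofReal.comp (by fun_prop))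
  · filter_upwards [coeFn_scaledPer h hb hl, coeFn_charMul j (scaledPer f lam),
      Lp.coeFn_smul (lam : ℂ) (charMul j (scaledPer f lam) - scaledPer f lam),
      Lp.coeFn_sub (charMul j (scaledPer f lam)) (scaledPer f lam)] with x e1 e2 e3 e4
    rw [e3, Pi.smul_apply, e4, Pi.sub_apply, e2, e1, smul_eq_mul]
    ring
  · exact measurable_const.mul
      (((contDiff_torusChar j).continuous.measurable).sub measurable_const)
  · rw [norm_mul, Complex.norm_real, Real.norm_of_nonneg hl.le, Real.rpow_one, mul_comm]
    gcongr
    refine (norm_sub_le _ _).trans ?_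
    rw [norm_torusChar, norm_one]
    norm_num
  · rw [norm_mul, norm_mul _ (f x), norm_mul, Complex.norm_real, Real.norm_of_nonneg hl.le]
    gcongr
    have e : (2 * Real.pi * Complex.I * x j : ℂ) * (lam⁻¹ : ℝ) =
        Complex.I * ((2 * Real.pi * x j * lam⁻¹ : ℝ) : ℂ) := by push_cast; ring
    rw [torusChar_inv_smul, e]
    -- With `θ = 2π xⱼ / lam` the factor `lam` cancels, leaving a bound free of `lam`.
    refine (mul_le_mul_of_nonneg_left (Real.norm_exp_I_mul_ofReal_sub_one_le) hl.le).trans ?_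
    rw [Real.norm_eq_abs, abs_mul _ lam⁻¹, abs_of_pos (inv_pos.2 hl), mul_comm,
      inv_mul_cancel_right₀ hl.ne']
    refine le_of_eq ?_
    simp [abs_mul]
  · simp only [torusChar_inv_smul]
    exact (tendsto_mul_exp_sub_one _).mul_const _

end ScaledPer

/-! ### Admissible functions -/

section AdmissibleFunctions

variable {d : ℕ} {f : Rd d → ℂ}

theorem Admissible.exists_hasDecay (hf : Admissible f) :
    ∃ b, HasDecay f b ∧ (d : ℝ) < b ∧ (d : ℝ) / 2 + 1 < b := by
  obtain ⟨C, -, b, hb, h⟩ := hf.decay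
  have hb1 : (d : ℝ) < b := (le_max_right _ _).trans_lt hb
  exact ⟨b, .of_le hf.contDiff.continuous ((Nat.cast_nonneg d).trans_lt hb1) h, hb1,
    (le_max_left _ _).trans_lt hb⟩

theorem Admissible.exists_hasDecay_fderiv (hf : Admissible f) :
    ∃ b, (∀ j, HasDecay (fun x => fderiv ℝ f x (stdVec j)) b) ∧ (d : ℝ) < b := by
  obtain ⟨C, -, b, hb, h⟩ := hf.decay_deriv
  exact ⟨b, fun j => .of_le ((hf.contDiff.continuous_fderiv one_ne_zero).clm_apply
    continuous_const) ((Nat.cast_nonneg d).trans_lt hb) fun x hx => h x hx j, hb⟩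

/-- A continuous function vanishing almost everywhere vanishes identically. -/
theorem Admissible.toLp_ne_zero (hf : Admissible f) : hf.memLp.toLp f ≠ 0 := by
  intro h
  refine hf.ne_zero ?_
  have h1 : f =ᵐ[volume] 0 := (MemLp.toLp_eq_toLp_iff hf.memLp (MemLp.zero' (ε := ℂ))).1
    (by rw [h]; exact (MemLp.toLp_zero _).symm)
  exact hf.contDiff.continuous.ae_eq_iff_eq volume continuous_const |>.1 h1

/-- The coordinate lowers the decay to `b - 1`, and square integrability needs `d < 2 (b - 1)`,
which is exactly the hypothesis. -/
theorem memLp_coord_mul {b : ℝ} (h : HasDecay f b) (hb : (d : ℝ) / 2 + 1 < b) (j : Fin d)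
    (z : ℂ) : MemLp (fun x => (z * x j) * f x) 2 volume := by
  have := ((h.coord_mul j).memLp (by linarith)).const_mul z
  simpa only [mul_assoc] using this

end AdmissibleFunctions

end GohGoodman

end

/-! ### The limit of the uncertainty products -/

open GohGoodman in
theorem theorem3p2 {d : ℕ} (hd : 0 < d) (f : Rd d → ℂ) (hf : Admissible f) :
    (∀ j : Fin d, hf.memLp.toLp f ∈ (opA j).domain ∧ hf.memLp.toLp f ∈ (opB j).domain) ∧
    (∀ lam : ℝ, 0 < lam →
      (∀ x : Rd d, Summable fun k : Fin d → ℤ => scale f lam (x + latticeVec k)) ∧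
      MemLp (periodization (scale f lam)) 2 (torusMeasure d) ∧
      ∀ j : Fin d,
        scaledPer f lam ∈ (opAT j).domain ∧
        scaledPer f lam ∈ (opBT j).domain ∧
        scaledPer f lam ∈ (commutator (opAT j) (opBT j)).domain) ∧
    (∀ᶠ lam : ℝ in Filter.atTop, ∀ j : Fin d,
      inner ℂ (scaledPer f lam)
        (val (commutator (opAT j) (opBT j)) (scaledPer f lam)) ≠ 0) ∧
    Filter.Tendsto (fun lam : ℝ => UPGGT (scaledPer f lam))
      Filter.atTop (nhds (UPGG (hf.memLp.toLp f))) := by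
  obtain ⟨b, hb, hdb, hdb'⟩ := hf.exists_hasDecay
  obtain ⟨c, hc, hdc⟩ := hf.exists_hasDecay_fderiv
  have hb0 : 0 < b := (Nat.cast_nonneg d).trans_lt hdb
  have hc0 : 0 < c := (Nat.cast_nonneg d).trans_lt hdc
  have hne := hf.toLp_ne_zero
  set f₀ : L2R d := hf.memLp.toLp f with hf₀
  have hmA (j : Fin d) := memLp_coord_mul hb hdb' j (2 * Real.pi)
  have hmX (j : Fin d) := memLp_coord_mul hb hdb' j (2 * Real.pi * Complex.I)
  have hmD (j : Fin d) : MemLp (fun x => fderiv ℝ f x (stdVec j)) 2 volume :=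
    (hc j).memLp (by linarith)
  have hgA (j : Fin d) : (f₀, (hmA j).toLp _) ∈ (opA j).graph := by
    refine mem_graph_mulOp ?_
    filter_upwards [(hmA j).coeFn_toLp, hf.memLp.coeFn_toLp] with x h1 h2
    rw [h1, hf₀, h2]
    push_cast
    ring
  have hgB (j : Fin d) := mem_graph_opB (isWeakDerivR_toLp hf.contDiff hf.memLp (hmD j))
  let D (j : Fin d) (lam : ℝ) : L2T d := scaledPer (fun x => fderiv ℝ f x (stdVec j)) lam
  -- The factor `lam` compensates for the concentration at the origin: the dilates of `E j lam`
  -- converge to `2πi xⱼ f`.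
  let E (j : Fin d) (lam : ℝ) : L2T d :=
    (lam : ℂ) • (charMul j (scaledPer f lam) - scaledPer f lam)
  have hgBT (j : Fin d) {lam : ℝ} (hl : 0 < lam) :
      IsWeakDerivT j (scaledPer f lam) ((lam : ℂ) • D j lam) :=
    isWeakDerivT_scaledPer hf.contDiff hb hdb (hc j) hdc hl
  have htF : Tendsto (fun lam => dilate lam (scaledPer f lam)) atTop (𝓝 f₀) :=
    tendsto_dilate_scaledPer hb hdb hf.memLp
  have htD (j : Fin d) : Tendsto (fun lam => dilate lam (D j lam)) atTop (𝓝 ((hmD j).toLp _)) :=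
    tendsto_dilate_scaledPer (hc j) hdc (hmD j)
  have htE (j : Fin d) : Tendsto (fun lam => dilate lam (E j lam)) atTop (𝓝 ((hmX j).toLp _)) :=
    tendsto_dilate_charMul_sub hb hdb hdb' (hmX j)
  have hchar (j : Fin d) {lam : ℝ} (hl : 0 < lam) :
      charMul j (scaledPer f lam) = scaledPer f lam + ((lam⁻¹ : ℝ) : ℂ) • E j lam := by
    have hl' : (lam : ℂ) ≠ 0 := by exact_mod_cast hl.ne'
    simp only [E]
    rw [Complex.ofReal_inv, inv_smul_smul₀ hl', add_sub_cancel]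
  -- By `hchar` the commutator acts as the identity plus `lam⁻¹` times a term whose dilates
  -- converge, so only `⟨f, f⟩` survives.
  have hcomm (j : Fin d) : Tendsto
      (fun lam => inner ℂ (scaledPer f lam)
        (val (commutator (opAT j) (opBT j)) (scaledPer f lam))) atTop
      (𝓝 (inner ℂ f₀ f₀)) := by
    have h1 : Tendsto (fun lam : ℝ => inner ℂ (dilate lam (scaledPer f lam))
        (dilate lam (scaledPer f lam)) + ((lam⁻¹ : ℝ) : ℂ) *
          inner ℂ (dilate lam (scaledPer f lam)) (dilate lam (E j lam))) atTop
        (𝓝 (inner ℂ f₀ f₀ + ((0 : ℝ) : ℂ) * inner ℂ f₀ ((hmX j).toLp _))) :=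
      (htF.inner htF).add (((Complex.continuous_ofReal.tendsto 0).comp
        tendsto_inv_atTop_zero).mul (htF.inner (htE j)))
    rw [Complex.ofReal_zero, zero_mul, add_zero] at h1
    refine h1.congr' ?_
    filter_upwards [eventually_gt_atTop 0] with lam hl
    rw [val_eq_of_mem_graph (mem_graph_commutator (hgBT j hl)), hchar j hl, inner_add_right,
      inner_smul_right, inner_dilate hl, inner_dilate hl]
  refine ⟨fun j => ⟨LinearPMap.mem_domain_of_mem_graph (hgA j),
    LinearPMap.mem_domain_of_mem_graph (hgB j)⟩, fun lam hl => ⟨(hb.scale hl hb0).summable hdb,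
      memLp_periodization_scale hb hdb hl, fun j => ⟨
        LinearPMap.mem_domain_of_mem_graph (mem_graph_opAT j _),
        LinearPMap.mem_domain_of_mem_graph (mem_graph_opBT (hgBT j hl)),
        LinearPMap.mem_domain_of_mem_graph (mem_graph_commutator (hgBT j hl))⟩⟩, ?_, ?_⟩
  · exact eventually_all.2 fun j => (hcomm j).eventually_ne (inner_self_ne_zero.2 hne)
  · have hA (j : Fin d) : Tendsto (fun lam => vecVariance (scaledPer f lam) (E j lam)) atTop
        (𝓝 (variance (opA j) f₀)) := by
      -- The limit `2πi xⱼ f` differs from the image of `f` under `opA j` by a unimodular factor,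
      -- which the variance ignores.
      have e : (hmX j).toLp _ = Complex.I • (hmA j).toLp _ := by
        refine Lp.ext ?_
        filter_upwards [(hmX j).coeFn_toLp, (hmA j).coeFn_toLp,
          Lp.coeFn_smul Complex.I ((hmA j).toLp _)] with x h1 h2 h3
        rw [h1, h3, Pi.smul_apply, h2, smul_eq_mul]
        ring
      have := tendsto_vecVariance_of_dilate hne htF (htE j)
      rwa [e, vecVariance_smul, Complex.norm_I, one_pow, one_mul,
        ← variance_eq_vecVariance (hgA j)] at this
    have hB (j : Fin d) : Tendsto (fun lam => vecVariance (scaledPer f lam)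
        ((Complex.I / (2 * Real.pi : ℂ)) • D j lam)) atTop (𝓝 (variance (opB j) f₀)) := by
      rw [variance_eq_vecVariance (hgB j)]
      simp only [vecVariance_smul]
      exact (tendsto_vecVariance_of_dilate hne htF (htD j)).const_mul _
    have hsum : ∑ _j : Fin d, ‖inner ℂ f₀ f₀‖ = d * ‖f₀‖ ^ 2 := by
      simp [inner_self_eq_norm_sq_to_K]
    have hlim := ((tendsto_finsetSum Finset.univ fun j _ => hA j).mul
      (tendsto_finsetSum Finset.univ fun j _ => hB j)).mul
      -- The limiting denominator `(d ‖f₀‖²)²` is non-zero because `d > 0` and `f₀ ≠ 0`.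
      (((tendsto_finsetSum Finset.univ fun j _ => (hcomm j).norm).pow 2).inv₀ (by
        rw [hsum]
        have := norm_ne_zero_iff.2 hne
        have : (d : ℝ) ≠ 0 := by exact_mod_cast hd.ne'
        positivity))
    have hval : UPGG f₀ = (∑ j, variance (opA j) f₀) * (∑ j, variance (opB j) f₀) *
        ((∑ _j : Fin d, ‖inner ℂ f₀ f₀‖) ^ 2)⁻¹ := by
      rw [UPGG, hsum]
      ring
    rw [hval]
    refine hlim.congr' ?_
    filter_upwards [eventually_gt_atTop 0] with lam hl
    have hl' : (lam : ℂ) ≠ 0 := by exact_mod_cast hl.ne'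
    have e1 (j : Fin d) : variance (opAT j) (scaledPer f lam) =
        lam⁻¹ ^ 2 * vecVariance (scaledPer f lam) (E j lam) := by
      rw [variance_eq_vecVariance (mem_graph_opAT j _), hchar j hl, vecVariance_add_self,
        vecVariance_smul, Complex.norm_real, Real.norm_of_nonneg (inv_nonneg.2 hl.le)]
    have e2 (j : Fin d) : variance (opBT j) (scaledPer f lam) =
        lam ^ 2 * vecVariance (scaledPer f lam) ((Complex.I / (2 * Real.pi : ℂ)) • D j lam) := by
      rw [variance_eq_vecVariance (mem_graph_opBT (hgBT j hl)), smul_comm, vecVariance_smul,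
        Complex.norm_real, Real.norm_of_nonneg hl.le]
    rw [UPGGT, uncertaintyProduct]
    -- The factors `lam⁻¹ ^ 2` and `lam ^ 2` come out of the two sums and cancel.
    simp only [e1, e2, ← Finset.mul_sum]
    field_simp
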